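/- Let $\alpha,g,d,\lambda>0$ and $\beta\in(0,1)$. All functions below are real-valued and $\lambda$-periodic in their first variable. For $\eta\in C^4(\mathbb R)$ with $\eta>-d$ put $\Omega_\eta=\{(x,y): -d<y<\eta(x)\}$, $\omega(\eta)=(1+\eta'^2)^{1/2}$ and $$H(\eta)=\omega(\eta)^{-1}\big[\omega(\eta)^{-1}\big(\omega(\eta)^{-3}\eta''\big)'\big]'+\tfrac12\big(\omega(\eta)^{-3}\eta''\big)^3 .$$ For $p_0<0$ put $\Omega=\mathbb R\times(p_0,0)$. Consider the following problems. (i) *Velocity formulation*, for $(u,v,P,\eta)$ with $u,v,P\in C^{1+\beta}(\overline{\Omega_\eta})$, $\eta\in C^4(\mathbb R)$, $\eta>-d$: $$uu_x+vu_y=-P_x,\qquad uv_x+vv_y=-P_y-g,\qquad u_x+v_y=0\quad\text{in }\Omega_\eta,$$ $$P=\alpha H(\eta)\ \text{ and }\ v=u\eta'\ \text{ on } y=\eta(x),\qquad v=0\ \text{ on } y=-d,\qquad \int_0^\lambda\eta\,dx=0,\qquad u<0\ \text{ in }\overline{\Omega_\eta}.$$ (ii) *Stream-function formulation*, for $(p_0,\gamma,\psi,\eta)$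 with $p_0<0$, $\gamma\in C^\beta([p_0,0])$, $\psi\in C^{2+\beta}(\overline{\Omega_\eta})$, $\eta\in C^4(\mathbb R)$, $\eta>-d$: $$\Delta\psi=\gamma(-\psi)\ \text{ in }\Omega_\eta,\qquad \psi=0\ \text{ on } y=\eta(x),\qquad \psi=-p_0\ \text{ on } y=-d,\qquad \psi_y<0\ \text{ in }\overline{\Omega_\eta},$$ $$|\nabla\psi|^2+2g\eta+2\alpha H(\eta)=\frac1\lambda\int_0^\lambda|\nabla\psi|^2(x,\eta(x))\,dx\quad\text{on } y=\eta(x).$$ (iii) *Height-function formulation*, for $(p_0,\gamma,h)$ with $p_0<0$, $\gamma\in C^\beta([p_0,0])$, $h\in C^{2+\beta}(\overline\Omega)$, $h(\cdot,0)\in C^4(\mathbb R)$: $$(1+h_q^2)h_{pp}-2h_ph_qh_{pq}+h_p^2h_{qq}-\gamma h_p^3=0\ \text{ in }\Omega,\qquad h=-d\ \text{ on } p=p_0,\qquad h_p>0\ \text{ in }\overline\Omega,$$ $$\frac{1+h_q^2}{h_p^2}+2gh+2\alpha H(h(\cdot,0))=\frac1\lambda\int_0^\lambda\frac{1+h_q^2}{h_p^2}(q,0)\,dq\quad\text{on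 } p=0.$$ These formulations are equivalent in the following sense. (a) For each solution $(u,v,P,\eta)$ of (i) there is exactly one $(p_0,\gamma,\psi)$ such that $(p_0,\gamma,\psi,\eta)$ solves (ii) and $\nabla\psi=(-v,u)$ in $\overline{\Omega_\eta}$. Conversely, for each solution $(p_0,\gamma,\psi,\eta)$ of (ii) there is exactly one $(u,v,P)$ such that $(u,v,P,\eta)$ solves (i) and $\nabla\psi=(-v,u)$ in $\overline{\Omega_\eta}$. (b) For each solution $(p_0,\gamma,\psi,\eta)$ of (ii) there is exactly one $h$ such that $(p_0,\gamma,h)$ solves (iii), $h(\cdot,0)=\eta$ and $h(x,-\psi(x,y))=y$ for all $(x,y)\in\overline{\Omega_\eta}$. Conversely, for each solution $(p_0,\gamma,h)$ of (iii) there is exactly one $(\psi,\eta)$ such that $(p_0,\gamma,\psi,\eta)$ solves (ii), $h(\cdot,0)=\eta$ and $h(x,-\psi(x,y))=y$ for all $(x,y)\in\overline{\Omega_\eta}$. -/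

import Mathlib

open scoped NNReal

noncomputable section

namespace Hydroelastic

/-- `f` belongs to the Hölder class `C^{k+β}(S)`, where `S` is the closure of a domain in the plane:
`f` is `k` times continuously differentiable up to the boundary and its derivatives of order `k` are
uniformly `β`-Hölder continuous on `S`. (All functions to which this is applied below are periodic
in the unbounded direction, hence bounded together with their derivatives.) -/
def HolderClass (k : ℕ) (β : ℝ≥0) (S : Set (ℝ × ℝ)) (f : ℝ × ℝ → ℝ) : Prop :=
  ContDiffOn ℝ k f S ∧ ∃ C : ℝ≥0, HolderOnWith C β (iteratedFDerivWithin ℝ k f S) S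

/-- Partial derivative in the first variable, up to the boundary of the closed region `S`
(at interior points of `S` this is the ordinary partial derivative). -/
def d₁ (S : Set (ℝ × ℝ)) (f : ℝ × ℝ → ℝ) (z : ℝ × ℝ) : ℝ := fderivWithin ℝ f S z (1, 0)

/-- Partial derivative in the second variable, up to the boundary of the closed region `S`. -/
def d₂ (S : Set (ℝ × ℝ)) (f : ℝ × ℝ → ℝ) (z : ℝ × ℝ) : ℝ := fderivWithin ℝ f S z (0, 1)

/-- The fluid domain `-d < y < η(x)`. -/
def fluid (d : ℝ) (η : ℝ → ℝ) : Set (ℝ × ℝ) := {z | -d < z.2 ∧ z.2 < η z.1}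

/-- The closed fluid domain `-d ≤ y ≤ η(x)`; this is the closure of `fluid d η` whenever `η` is
continuous with `η > -d`. -/
def fluidBar (d : ℝ) (η : ℝ → ℝ) : Set (ℝ × ℝ) := {z | -d ≤ z.2 ∧ z.2 ≤ η z.1}

/-- The open strip `ℝ × (p₀, 0)`. -/
def strip (p₀ : ℝ) : Set (ℝ × ℝ) := {z | p₀ < z.2 ∧ z.2 < 0}

/-- The closed strip `ℝ × [p₀, 0]`. -/
def stripBar (p₀ : ℝ) : Set (ℝ × ℝ) := {z | p₀ ≤ z.2 ∧ z.2 ≤ 0}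

/-- `f` is `lam`-periodic in its first variable on `S`. -/
def PeriodicOn (lam : ℝ) (S : Set (ℝ × ℝ)) (f : ℝ × ℝ → ℝ) : Prop :=
  ∀ z ∈ S, f (z.1 + lam, z.2) = f z

/-- `ω(η) = (1 + η'^2)^{1/2}`. -/
def arc (η : ℝ → ℝ) (x : ℝ) : ℝ := Real.sqrt (1 + deriv η x ^ 2)

/-- `ω(η)^{-3} η''`, the curvature of the graph of `η`. -/
def curv (η : ℝ → ℝ) (x : ℝ) : ℝ := (arc η x ^ 3)⁻¹ * deriv (deriv η) x

/-- `H(η) = ω⁻¹ [ω⁻¹ (ω⁻³ η'')']' + (ω⁻³ η'')³ / 2`, where `ω = ω(η)`. -/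
def bending (η : ℝ → ℝ) (x : ℝ) : ℝ :=
  (arc η x)⁻¹ * deriv (fun s => (arc η s)⁻¹ * deriv (curv η) s) x + 1 / 2 * curv η x ^ 3

/-- The velocity formulation: `(u, v, P, η)` with `u, v, P ∈ C^{1+β}`, `η ∈ C⁴`, `lam`-periodic. -/
structure VelocitySolution (α g d lam : ℝ) (β : ℝ≥0) (u v P : ℝ × ℝ → ℝ) (η : ℝ → ℝ) : Prop where
  surface_above_bed : ∀ x, -d < η x
  regular_η : ContDiff ℝ 4 η
  regular_u : HolderClass 1 β (fluidBar d η) u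
  regular_v : HolderClass 1 β (fluidBar d η) v
  regular_P : HolderClass 1 β (fluidBar d η) P
  periodic_η : Function.Periodic η lam
  periodic_u : PeriodicOn lam (fluidBar d η) u
  periodic_v : PeriodicOn lam (fluidBar d η) v
  periodic_P : PeriodicOn lam (fluidBar d η) P
  momentum_x : ∀ z ∈ fluid d η,
    u z * d₁ (fluidBar d η) u z + v z * d₂ (fluidBar d η) u z = -d₁ (fluidBar d η) P z
  momentum_y : ∀ z ∈ fluid d η,
    u z * d₁ (fluidBar d η) v z + v z * d₂ (fluidBar d η) v z = -d₂ (fluidBar d η) P z - g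
  incompressible : ∀ z ∈ fluid d η, d₁ (fluidBar d η) u z + d₂ (fluidBar d η) v z = 0
  dynamic : ∀ x, P (x, η x) = α * bending η x
  kinematic_surface : ∀ x, v (x, η x) = u (x, η x) * deriv η x
  kinematic_bed : ∀ x, v (x, -d) = 0
  mean_zero : ∫ x in (0 : ℝ)..lam, η x = 0
  no_stagnation : ∀ z ∈ fluidBar d η, u z < 0

/-- The stream-function formulation: `ψ ∈ C^{2+β}`, `η ∈ C⁴`, `γ ∈ C^β([p₀, 0])`, `lam`-periodic. -/
structure StreamSolution (α g d lam : ℝ) (β : ℝ≥0) (p₀ : ℝ) (γ : ℝ → ℝ) (ψ : ℝ × ℝ → ℝ)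
    (η : ℝ → ℝ) : Prop where
  p₀_neg : p₀ < 0
  surface_above_bed : ∀ x, -d < η x
  regular_η : ContDiff ℝ 4 η
  regular_ψ : HolderClass 2 β (fluidBar d η) ψ
  regular_γ : ∃ C : ℝ≥0, HolderOnWith C β γ (Set.Icc p₀ 0)
  periodic_η : Function.Periodic η lam
  periodic_ψ : PeriodicOn lam (fluidBar d η) ψ
  poisson : ∀ z ∈ fluid d η,
    d₁ (fluidBar d η) (d₁ (fluidBar d η) ψ) z + d₂ (fluidBar d η) (d₂ (fluidBar d η) ψ) z
      = γ (-ψ z)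
  surface : ∀ x, ψ (x, η x) = 0
  bed : ∀ x, ψ (x, -d) = -p₀
  bernoulli : ∀ x,
    d₁ (fluidBar d η) ψ (x, η x) ^ 2 + d₂ (fluidBar d η) ψ (x, η x) ^ 2
        + 2 * g * η x + 2 * α * bending η x
      = 1 / lam * ∫ s in (0 : ℝ)..lam,
          (d₁ (fluidBar d η) ψ (s, η s) ^ 2 + d₂ (fluidBar d η) ψ (s, η s) ^ 2)
  no_stagnation : ∀ z ∈ fluidBar d η, d₂ (fluidBar d η) ψ z < 0

/-- The height-function formulation: `h ∈ C^{2+β}`, `h(·, 0) ∈ C⁴`, `γ ∈ C^β([p₀, 0])`,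
`lam`-periodic. -/
structure HeightSolution (α g d lam : ℝ) (β : ℝ≥0) (p₀ : ℝ) (γ : ℝ → ℝ) (h : ℝ × ℝ → ℝ) :
    Prop where
  p₀_neg : p₀ < 0
  regular_h : HolderClass 2 β (stripBar p₀) h
  regular_trace : ContDiff ℝ 4 (fun q => h (q, 0))
  regular_γ : ∃ C : ℝ≥0, HolderOnWith C β γ (Set.Icc p₀ 0)
  periodic_h : PeriodicOn lam (stripBar p₀) h
  elliptic : ∀ z ∈ strip p₀,
    (1 + d₁ (stripBar p₀) h z ^ 2) * d₂ (stripBar p₀) (d₂ (stripBar p₀) h) z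
      - 2 * d₂ (stripBar p₀) h z * d₁ (stripBar p₀) h z
          * d₂ (stripBar p₀) (d₁ (stripBar p₀) h) z
      + d₂ (stripBar p₀) h z ^ 2 * d₁ (stripBar p₀) (d₁ (stripBar p₀) h) z
      - γ z.2 * d₂ (stripBar p₀) h z ^ 3 = 0
  bed : ∀ q, h (q, p₀) = -d
  bernoulli : ∀ q,
    (1 + d₁ (stripBar p₀) h (q, 0) ^ 2) / d₂ (stripBar p₀) h (q, 0) ^ 2
        + 2 * g * h (q, 0) + 2 * α * bending (fun s => h (s, 0)) q
      = 1 / lam * ∫ s in (0 : ℝ)..lam,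
          (1 + d₁ (stripBar p₀) h (s, 0) ^ 2) / d₂ (stripBar p₀) h (s, 0) ^ 2
  no_stagnation : ∀ z ∈ stripBar p₀, 0 < d₂ (stripBar p₀) h z

/-- `ψ` is a stream function of the velocity field `(u, v)`: `∇ψ = (-v, u)`. -/
def IsStreamFunctionOf (d : ℝ) (η : ℝ → ℝ) (ψ u v : ℝ × ℝ → ℝ) : Prop :=
  ∀ z ∈ fluidBar d η, d₁ (fluidBar d η) ψ z = -v z ∧ d₂ (fluidBar d η) ψ z = u z

/-- `h` is the height function belonging to `(ψ, η)`: `h(·, 0) = η`, and `h(q, p) = y` at the point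
`(q, p) = (x, -ψ(x, y))`, for all `(x, y)` in the closed fluid domain. -/
def IsHeightFunctionOf (d : ℝ) (η : ℝ → ℝ) (ψ h : ℝ × ℝ → ℝ) : Prop :=
  (∀ x, h (x, 0) = η x) ∧ ∀ z ∈ fluidBar d η, h (z.1, -ψ z) = z.2

end Hydroelastic

end

open scoped NNReal
open Set Filter Topology Hydroelastic

namespace Hydroelastic

/-! The three formulations describe one flow, in two coordinate systems. Incompressibility makes `-v
dx + u dy` closed; `Profile.exists_hasGrad` makes it exact up to the boundary, and the kinematic
conditions make the potential `ψ` constant on surface and bed. As `u < 0`, `-ψ` increases from `p₀`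
to `0` on each vertical, so `Profile.exists_verticalInverse` inverts it in the second variable. By
the Euler equations the total head `E = P + (u² + v²)/2 + gy` satisfies `∇E = ζ∇ψ` with `ζ = u_y -
v_x`. In the coordinates `(x, p)`, `p = -ψ`, the head therefore depends on `p` alone, and so does
its `p`-derivative `-ζ`. This produces `γ`, and constancy of `E` on `p = 0` is the Bernoulli
condition. Conversely, Bernoulli's law, with a primitive of `γ`, defines the pressure.

The two normalisations match because the bending force is the derivative of a periodic function
(`hasDerivAt_bending`): integrating the Bernoulli condition with constant `C` over a period leaves
`∫ |∇ψ|² = C lam - 2g ∫ η`. Since `g > 0`, `η` has mean zero exactly when `C` is the mean of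
`|∇ψ|²`.

The height function is the vertical inverse of `-ψ`, and conversely. The strip is itself a fluid
domain with a flat surface, so one inversion lemma serves both directions, and
`IsVerticalInverse.hasGrad_grad` converts one differential equation into the other.

`HolderClass` gives Hölder control of the top derivatives only. The proof works with `Hol`, which
has bounds and Hölder estimates at every order and is stable under products, reciprocals and
composition; periodicity and compactness of one period give the passage (`Profile.hol_one`,
`Profile.hol_two`). -/

/-- `f` has the gradient `(a, b)` on `S`, up to the boundary. -/
def HasGrad (S : Set (ℝ × ℝ)) (f a b : ℝ × ℝ → ℝ) : Prop :=
  ∀ z ∈ S, HasFDerivWithinAt f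
    (a z • ContinuousLinearMap.fst ℝ ℝ ℝ + b z • ContinuousLinearMap.snd ℝ ℝ ℝ) S z

/-! ### Calculus of gradients up to the boundary -/

section HasGrad

variable {S S' : Set (ℝ × ℝ)} {f f' a b g a' b' : ℝ × ℝ → ℝ}

theorem clm_eq (l : ℝ × ℝ →L[ℝ] ℝ) :
    l = l (1, 0) • ContinuousLinearMap.fst ℝ ℝ ℝ + l (0, 1) • ContinuousLinearMap.snd ℝ ℝ ℝ := by
  ext <;> simp

theorem HasGrad.of_hasFDerivWithinAt {l : ℝ × ℝ → (ℝ × ℝ →L[ℝ] ℝ)}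
    (h : ∀ z ∈ S, HasFDerivWithinAt f (l z) S z) :
    HasGrad S f (fun z => l z (1, 0)) (fun z => l z (0, 1)) := by
  intro z hz
  rw [← clm_eq]
  exact h z hz

theorem HasGrad.continuousOn (h : HasGrad S f a b) : ContinuousOn f S :=
  fun z hz => (h z hz).continuousWithinAt

theorem HasGrad.congr (h : HasGrad S f a b) (hf : EqOn f' f S) (ha : EqOn a' a S)
    (hb : EqOn b' b S) : HasGrad S f' a' b' := by
  intro z hz
  rw [ha hz, hb hz]
  exact (h z hz).congr hf (hf hz)

theorem HasGrad.d₁_eq (h : HasGrad S f a b) (hS : UniqueDiffOn ℝ S) : EqOn (d₁ S f) a S := by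
  intro z hz
  simp [d₁, (h z hz).fderivWithin (hS z hz)]

theorem HasGrad.d₂_eq (h : HasGrad S f a b) (hS : UniqueDiffOn ℝ S) : EqOn (d₂ S f) b S := by
  intro z hz
  simp [d₂, (h z hz).fderivWithin (hS z hz)]

theorem HasGrad.unique (h : HasGrad S f a b) (h' : HasGrad S f a' b') (hS : UniqueDiffOn ℝ S) :
    EqOn a a' S ∧ EqOn b b' S :=
  ⟨fun _ hz => (h.d₁_eq hS hz).symm.trans (h'.d₁_eq hS hz),
    fun _ hz => (h.d₂_eq hS hz).symm.trans (h'.d₂_eq hS hz)⟩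

theorem hasGrad_d₁_d₂ (h : DifferentiableOn ℝ f S) : HasGrad S f (d₁ S f) (d₂ S f) :=
  HasGrad.of_hasFDerivWithinAt fun z hz => (h z hz).hasFDerivWithinAt

theorem d₁_congr (h : EqOn f g S) : EqOn (d₁ S f) (d₁ S g) S := by
  intro z hz
  simp only [d₁, fderivWithin_congr h (h hz)]

theorem d₂_congr (h : EqOn f g S) : EqOn (d₂ S f) (d₂ S g) S := by
  intro z hz
  simp only [d₂, fderivWithin_congr h (h hz)]

theorem hasGrad_const (c : ℝ) : HasGrad S (fun _ => c) (fun _ => 0) (fun _ => 0) := by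
  intro z _
  simpa using hasFDerivWithinAt_const c z S

theorem hasGrad_fst : HasGrad S (fun z => z.1) (fun _ => 1) (fun _ => 0) := by
  intro z _
  simpa using (ContinuousLinearMap.fst ℝ ℝ ℝ).hasFDerivWithinAt

theorem hasGrad_snd : HasGrad S (fun z => z.2) (fun _ => 0) (fun _ => 1) := by
  intro z _
  simpa using (ContinuousLinearMap.snd ℝ ℝ ℝ).hasFDerivWithinAt

theorem HasGrad.add (h : HasGrad S f a b) (h' : HasGrad S g a' b') :
    HasGrad S (fun z => f z + g z) (fun z => a z + a' z) (fun z => b z + b' z) := by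
  intro z hz
  refine ((h z hz).add (h' z hz)).congr_fderiv ?_
  ext <;> simp

theorem HasGrad.neg (h : HasGrad S f a b) :
    HasGrad S (fun z => -f z) (fun z => -a z) (fun z => -b z) := by
  intro z hz
  refine (h z hz).neg.congr_fderiv ?_
  ext <;> simp

theorem HasGrad.sub (h : HasGrad S f a b) (h' : HasGrad S g a' b') :
    HasGrad S (fun z => f z - g z) (fun z => a z - a' z) (fun z => b z - b' z) := by
  simpa only [sub_eq_add_neg] using h.add h'.neg

theorem HasGrad.mul (h : HasGrad S f a b) (h' : HasGrad S g a' b') :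
    HasGrad S (fun z => f z * g z) (fun z => f z * a' z + a z * g z)
      (fun z => f z * b' z + b z * g z) := by
  intro z hz
  refine ((h z hz).mul (h' z hz)).congr_fderiv ?_
  ext <;> simp <;> ring

theorem HasGrad.comp_deriv {G G' : ℝ → ℝ} {s : Set ℝ} (h : HasGrad S f a b) (hf : MapsTo f S s)
    (hG : ∀ x ∈ s, HasDerivWithinAt G (G' x) s x) :
    HasGrad S (fun z => G (f z)) (fun z => G' (f z) * a z) (fun z => G' (f z) * b z) := by
  intro z hz
  refine ((hG (f z) (hf hz)).comp_hasFDerivWithinAt z (h z hz) hf).congr_fderiv ?_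
  ext <;> simp

theorem HasGrad.inv (h : HasGrad S f a b) (h0 : ∀ z ∈ S, f z ≠ 0) :
    HasGrad S (fun z => (f z)⁻¹) (fun z => -((f z)⁻¹ * (f z)⁻¹ * a z))
      (fun z => -((f z)⁻¹ * (f z)⁻¹ * b z)) := by
  refine (h.comp_deriv (s := {0}ᶜ) (G := fun x => x⁻¹) (G' := fun x => -(x ^ 2)⁻¹) h0
    fun x hx => (hasDerivAt_inv hx).hasDerivWithinAt).congr (fun _ _ => rfl) ?_ ?_ <;>
  · intro z _
    simp only
    ring

/-- Chain rule for maps that preserve the first variable. -/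
theorem HasGrad.comp_graph {k kx ky : ℝ × ℝ → ℝ} (h : HasGrad S f a b)
    (hk : HasGrad S' k kx ky) (hm : ∀ z ∈ S', (z.1, k z) ∈ S) :
    HasGrad S' (fun z => f (z.1, k z)) (fun z => a (z.1, k z) + b (z.1, k z) * kx z)
      (fun z => b (z.1, k z) * ky z) := by
  intro z hz
  have h1 : HasFDerivWithinAt (fun z : ℝ × ℝ => (z.1, k z)) _ S' z :=
    (hasFDerivWithinAt_fst (𝕜 := ℝ)).prodMk (hk z hz)
  refine ((h _ (hm z hz)).comp z h1 hm).congr_fderiv ?_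
  ext <;> simp

/-- Derivative along a curve in `S`. -/
theorem HasGrad.hasDerivWithinAt_comp {c₁ c₂ : ℝ → ℝ} {v₁ v₂ t : ℝ} {s : Set ℝ}
    (h : HasGrad S f a b) (h₁ : HasDerivWithinAt c₁ v₁ s t) (h₂ : HasDerivWithinAt c₂ v₂ s t)
    (ht : t ∈ s) (hm : ∀ t ∈ s, (c₁ t, c₂ t) ∈ S) :
    HasDerivWithinAt (fun t => f (c₁ t, c₂ t))
      (a (c₁ t, c₂ t) * v₁ + b (c₁ t, c₂ t) * v₂) s t := by
  refine ((h _ (hm t ht)).comp_hasDerivWithinAt t (h₁.prodMk h₂) hm).congr_deriv ?_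
  simp

end HasGrad

/-! ### Bounded Hölder functions -/

/-- `f` is bounded and uniformly `β`-Hölder continuous on `S`. -/
def BddHolder {X : Type*} [PseudoMetricSpace X] (β : ℝ≥0) (S : Set X) (f : X → ℝ) : Prop :=
  ∃ M : ℝ, 0 ≤ M ∧ (∀ z ∈ S, |f z| ≤ M) ∧
    ∀ z ∈ S, ∀ w ∈ S, |f z - f w| ≤ M * dist z w ^ (β : ℝ)

theorem holderOnWith_of_dist {X Y : Type*} [PseudoMetricSpace X] [PseudoMetricSpace Y]
    {C r : ℝ≥0} {f : X → Y} {s : Set X}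
    (h : ∀ x ∈ s, ∀ y ∈ s, dist (f x) (f y) ≤ C * dist x y ^ (r : ℝ)) : HolderOnWith C r f s := by
  intro x hx y hy
  have := h x hx y hy
  rw [edist_dist, edist_dist, ENNReal.ofReal_rpow_of_nonneg dist_nonneg r.coe_nonneg,
    ← ENNReal.ofReal_coe_nnreal, ← ENNReal.ofReal_mul C.coe_nonneg]
  exact ENNReal.ofReal_le_ofReal this

theorem exists_holderOnWith_of_dist {X Y : Type*} [PseudoMetricSpace X] [PseudoMetricSpace Y]
    {C : ℝ} {r : ℝ≥0} {f : X → Y} {s : Set X} (hC : 0 ≤ C)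
    (h : ∀ x ∈ s, ∀ y ∈ s, dist (f x) (f y) ≤ C * dist x y ^ (r : ℝ)) :
    ∃ C : ℝ≥0, HolderOnWith C r f s :=
  ⟨C.toNNReal, holderOnWith_of_dist (by rwa [Real.coe_toNNReal C hC])⟩

section BddHolder

variable {X Y : Type*} [PseudoMetricSpace X] [PseudoMetricSpace Y] {β : ℝ≥0} {S : Set X}
  {f g : X → ℝ}

theorem BddHolder.exists_holderOnWith (h : BddHolder β S f) :
    ∃ C : ℝ≥0, HolderOnWith C β f S := by
  obtain ⟨M, hM, -, h2⟩ := h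
  exact exists_holderOnWith_of_dist hM fun x hx y hy => h2 x hx y hy

theorem BddHolder.of_holderOnWith {C : ℝ≥0} {M : ℝ} (h : HolderOnWith C β f S)
    (hM : ∀ z ∈ S, |f z| ≤ M) : BddHolder β S f := by
  refine ⟨max M C, le_max_of_le_right C.2, fun z hz => (hM z hz).trans (le_max_left _ _), ?_⟩
  intro z hz w hw
  have := h.dist_le hz hw
  rw [Real.dist_eq] at this
  refine this.trans ?_
  gcongr
  exact le_max_right _ _

theorem BddHolder.congr (h : BddHolder β S f) (hf : EqOn g f S) : BddHolder β S g := by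
  obtain ⟨M, hM, h1, h2⟩ := h
  refine ⟨M, hM, fun z hz => by rw [hf hz]; exact h1 z hz, fun z hz w hw => ?_⟩
  rw [hf hz, hf hw]
  exact h2 z hz w hw

theorem bddHolder_const (c : ℝ) : BddHolder β S (fun _ => c) :=
  ⟨|c|, abs_nonneg _, fun _ _ => le_rfl, fun _ _ _ _ => by simp; positivity⟩

theorem BddHolder.add (hf : BddHolder β S f) (hg : BddHolder β S g) :
    BddHolder β S (fun z => f z + g z) := by
  obtain ⟨M, hM, h1, h2⟩ := hf
  obtain ⟨N, hN, k1, k2⟩ := hg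
  refine ⟨M + N, by positivity, fun z hz => (abs_add_le _ _).trans (add_le_add (h1 z hz) (k1 z hz)),
    fun z hz w hw => ?_⟩
  calc |f z + g z - (f w + g w)| = |(f z - f w) + (g z - g w)| := by ring_nf
    _ ≤ |f z - f w| + |g z - g w| := abs_add_le _ _
    _ ≤ M * dist z w ^ (β : ℝ) + N * dist z w ^ (β : ℝ) := add_le_add (h2 z hz w hw) (k2 z hz w hw)
    _ = _ := by ring

theorem BddHolder.mul (hf : BddHolder β S f) (hg : BddHolder β S g) :
    BddHolder β S (fun z => f z * g z) := by
  obtain ⟨M, hM, h1, h2⟩ := hf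
  obtain ⟨N, hN, k1, k2⟩ := hg
  have h12 : M * N ≤ M * N + M * N := by nlinarith [mul_nonneg hM hN]
  refine ⟨M * N + M * N, by positivity, fun z hz => ?_, fun z hz w hw => ?_⟩
  · rw [abs_mul]
    exact (mul_le_mul (h1 z hz) (k1 z hz) (abs_nonneg _) hM).trans h12
  · calc |f z * g z - f w * g w| = |f z * (g z - g w) + (f z - f w) * g w| := by ring_nf
      _ ≤ |f z * (g z - g w)| + |(f z - f w) * g w| := abs_add_le _ _
      _ = |f z| * |g z - g w| + |f z - f w| * |g w| := by rw [abs_mul, abs_mul]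
      _ ≤ M * (N * dist z w ^ (β : ℝ)) + M * dist z w ^ (β : ℝ) * N := by
          have := h1 z hz
          have := k1 w hw
          have := h2 z hz w hw
          have := k2 z hz w hw
          gcongr
      _ = _ := by ring

theorem BddHolder.inv {c : ℝ} (hf : BddHolder β S f) (hc : 0 < c) (h : ∀ z ∈ S, c ≤ |f z|) :
    BddHolder β S (fun z => (f z)⁻¹) := by
  obtain ⟨M, hM, h1, h2⟩ := hf
  have hinv : ∀ z ∈ S, |(f z)⁻¹| ≤ c⁻¹ := fun z hz => by
    rw [abs_inv]; exact inv_anti₀ hc (h z hz)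
  have hne : ∀ z ∈ S, f z ≠ 0 := fun z hz h0 => by
    have := h z hz
    rw [h0, abs_zero] at this
    linarith
  refine ⟨c⁻¹ + c⁻¹ * c⁻¹ * M, by positivity,
    fun z hz => (hinv z hz).trans (le_add_of_nonneg_right (by positivity)), fun z hz w hw => ?_⟩
  calc |(f z)⁻¹ - (f w)⁻¹| = |(f z)⁻¹| * |(f w)⁻¹| * |f z - f w| := by
        rw [abs_sub_comm (f z), ← abs_mul, ← abs_mul]
        have := hne z hz
        have := hne w hw
        congr 1
        field_simp
    _ ≤ c⁻¹ * c⁻¹ * (M * dist z w ^ (β : ℝ)) := by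
        have := hinv z hz
        have := hinv w hw
        have := h2 z hz w hw
        gcongr
    _ ≤ _ := by
        have : 0 ≤ c⁻¹ * dist z w ^ (β : ℝ) := by positivity
        linarith

theorem BddHolder.comp_lipschitz {T : Set Y} {K : Y → X} {L : ℝ} (hf : BddHolder β S f)
    (hK : MapsTo K T S) (hL : ∀ z ∈ T, ∀ w ∈ T, dist (K z) (K w) ≤ L * dist z w) :
    BddHolder β T (fun z => f (K z)) := by
  obtain ⟨M, hM, h1, h2⟩ := hf
  have hL' : ∀ z ∈ T, ∀ w ∈ T, dist (K z) (K w) ≤ max L 0 * dist z w := fun z hz w hw =>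
    (hL z hz w hw).trans (by gcongr; exact le_max_left _ _)
  have hL0 : 0 ≤ max L 0 := le_max_right _ _
  refine ⟨M + M * max L 0 ^ (β : ℝ), by positivity, fun z hz => (h1 _ (hK hz)).trans
    (le_add_of_nonneg_right (by positivity)), fun z hz w hw => ?_⟩
  calc |f (K z) - f (K w)| ≤ M * dist (K z) (K w) ^ (β : ℝ) := h2 _ (hK hz) _ (hK hw)
    _ ≤ M * (max L 0 * dist z w) ^ (β : ℝ) := by
        gcongr
        exact hL' z hz w hw
    _ = M * max L 0 ^ (β : ℝ) * dist z w ^ (β : ℝ) := by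
        rw [Real.mul_rpow hL0 dist_nonneg]; ring
    _ ≤ _ := by
        have : 0 ≤ M * dist z w ^ (β : ℝ) := by positivity
        linarith

/-- At distances `t ≤ 1` one has `t ≤ t ^ β`, so the Lipschitz bound suffices; at larger distances
boundedness does. -/
theorem BddHolder.of_lipschitz {M L : ℝ} (hβ : β < 1) (hM : ∀ z ∈ S, |f z| ≤ M)
    (hL : ∀ z ∈ S, ∀ w ∈ S, |f z - f w| ≤ L * dist z w) : BddHolder β S f := by
  -- `S` may be empty or a single point, so neither constant need be nonnegative.
  have hmM : M ≤ max M 0 := le_max_left _ _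
  have hmL : L ≤ max L 0 := le_max_left _ _
  have hM0 : 0 ≤ max M 0 := le_max_right _ _
  have hL0 : 0 ≤ max L 0 := le_max_right _ _
  refine ⟨2 * max M 0 + max L 0, by positivity, fun z hz => by linarith [hM z hz],
    fun z hz w hw => ?_⟩
  rcases le_total (dist z w) 1 with h1 | h1
  · have h2 : dist z w ≤ dist z w ^ (β : ℝ) := by
      have := Real.rpow_le_rpow_of_exponent_ge' dist_nonneg h1 β.2 (z := (β : ℝ)) (y := 1)
        (by exact_mod_cast hβ.le)
      simpa using this
    calc |f z - f w| ≤ L * dist z w := hL z hz w hw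
      _ ≤ max L 0 * dist z w ^ (β : ℝ) := by gcongr
      _ ≤ _ := by gcongr; linarith
  · have h2 : 1 ≤ dist z w ^ (β : ℝ) := Real.one_le_rpow h1 β.2
    calc |f z - f w| ≤ |f z| + |f w| := abs_sub _ _
      _ ≤ (2 * max M 0 + max L 0) * 1 := by linarith [hM z hz, hM w hw]
      _ ≤ _ := by gcongr

end BddHolder

/-! ### Hölder classes of higher order -/

/-- `f` and its derivatives up to the order `k` are bounded and uniformly `β`-Hölder continuous on
`S`, up to the boundary. -/
def Hol (β : ℝ≥0) (S : Set (ℝ × ℝ)) : ℕ → (ℝ × ℝ → ℝ) → Prop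
  | 0, f => BddHolder β S f
  | k + 1, f => BddHolder β S f ∧ ∃ a b, HasGrad S f a b ∧ Hol β S k a ∧ Hol β S k b

section Hol

variable {S S' : Set (ℝ × ℝ)} {β : ℝ≥0} {k : ℕ} {f g a b : ℝ × ℝ → ℝ}

theorem Hol.bddHolder (h : Hol β S k f) : BddHolder β S f := by
  cases k with
  | zero => exact h
  | succ k => exact h.1

theorem Hol.of_succ (h : Hol β S (k + 1) f) : Hol β S k f := by
  induction k generalizing f with
  | zero => exact h.1
  | succ k ih =>
    obtain ⟨h0, a, b, h1, h2, h3⟩ := h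
    exact ⟨h0, a, b, h1, ih h2, ih h3⟩

theorem Hol.congr (h : Hol β S k f) (hf : EqOn g f S) : Hol β S k g := by
  cases k with
  | zero => exact BddHolder.congr h hf
  | succ k =>
    obtain ⟨h0, a, b, h1, h2, h3⟩ := h
    exact ⟨h0.congr hf, a, b, h1.congr hf (fun _ _ => rfl) (fun _ _ => rfl), h2, h3⟩

theorem Hol.grad (h : Hol β S (k + 1) f) (hS : UniqueDiffOn ℝ S) (hf : HasGrad S f a b) :
    Hol β S k a ∧ Hol β S k b := by
  obtain ⟨-, a', b', h1, h2, h3⟩ := h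
  have := hf.unique h1 hS
  exact ⟨h2.congr this.1, h3.congr this.2⟩

theorem hol_const (c : ℝ) : Hol β S k (fun _ => c) := by
  induction k generalizing c with
  | zero => exact bddHolder_const c
  | succ k ih => exact ⟨bddHolder_const c, _, _, hasGrad_const c, ih 0, ih 0⟩

theorem Hol.add (hf : Hol β S k f) (hg : Hol β S k g) : Hol β S k (fun z => f z + g z) := by
  induction k generalizing f g with
  | zero => exact BddHolder.add hf hg
  | succ k ih =>
    obtain ⟨h0, a, b, h1, h2, h3⟩ := hf
    obtain ⟨k0, a', b', k1, k2, k3⟩ := hg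
    exact ⟨h0.add k0, _, _, h1.add k1, ih h2 k2, ih h3 k3⟩

theorem Hol.mul (hf : Hol β S k f) (hg : Hol β S k g) : Hol β S k (fun z => f z * g z) := by
  induction k generalizing f g with
  | zero => exact BddHolder.mul hf hg
  | succ k ih =>
    have hf' := hf.of_succ
    have hg' := hg.of_succ
    obtain ⟨h0, a, b, h1, h2, h3⟩ := hf
    obtain ⟨k0, a', b', k1, k2, k3⟩ := hg
    exact ⟨h0.mul k0, _, _, h1.mul k1, (ih hf' k2).add (ih h2 hg'), (ih hf' k3).add (ih h3 hg')⟩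

theorem Hol.neg (hf : Hol β S k f) : Hol β S k (fun z => -f z) :=
  ((hol_const (-1)).mul hf).congr fun z _ => by simp

theorem Hol.sub (hf : Hol β S k f) (hg : Hol β S k g) : Hol β S k (fun z => f z - g z) :=
  (hf.add hg.neg).congr fun z _ => by simp [sub_eq_add_neg]

theorem Hol.inv {c : ℝ} (hf : Hol β S k f) (hc : 0 < c) (h : ∀ z ∈ S, c ≤ |f z|) :
    Hol β S k (fun z => (f z)⁻¹) := by
  induction k with
  | zero => exact BddHolder.inv hf hc h
  | succ k ih =>
    have hne : ∀ z ∈ S, f z ≠ 0 := fun z hz h0 => by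
      have := h z hz
      rw [h0, abs_zero] at this
      linarith
    have hf' := ih hf.of_succ
    obtain ⟨h0, a, b, h1, h2, h3⟩ := hf
    exact ⟨h0.inv hc h, _, _, h1.inv hne, ((hf'.mul hf').mul h2).neg, ((hf'.mul hf').mul h3).neg⟩

/-- The Lipschitz bound on `κ` is a separate hypothesis: at order zero `κ` is merely Hölder, and
composing two Hölder maps would lower the exponent. -/
theorem Hol.comp_graph {κ : ℝ × ℝ → ℝ} {L : ℝ} (hf : Hol β S k f) (hκ : Hol β S' k κ)
    (hm : ∀ z ∈ S', (z.1, κ z) ∈ S)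
    (hL : ∀ z ∈ S', ∀ w ∈ S', |κ z - κ w| ≤ L * dist z w) :
    Hol β S' k (fun z => f (z.1, κ z)) := by
  have key : ∀ {f}, BddHolder β S f → BddHolder β S' (fun z => f (z.1, κ z)) := fun {f} h => by
    refine BddHolder.comp_lipschitz (K := fun z : ℝ × ℝ => (z.1, κ z)) (L := max 1 L) h hm
      fun z hz w hw => ?_
    rw [Prod.dist_eq]
    refine max_le ?_ ?_
    · calc dist z.1 w.1 ≤ dist z w := le_max_left _ _
        _ = 1 * dist z w := (one_mul _).symm
        _ ≤ _ := by gcongr; exact le_max_left _ _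
    · refine (hL z hz w hw).trans ?_
      gcongr
      exact le_max_right _ _
  induction k generalizing f with
  | zero => exact key hf
  | succ k ih =>
    have hκ' := hκ.of_succ
    obtain ⟨h0, a, b, h1, h2, h3⟩ := hf
    obtain ⟨k0, a', b', k1, k2, k3⟩ := hκ
    exact ⟨key h0, _, _, h1.comp_graph k1 hm, (ih h2 hκ').add ((ih h3 hκ').mul k2),
      (ih h3 hκ').mul k3⟩

theorem BddHolder.continuousOn {X : Type*} [PseudoMetricSpace X] {S : Set X} {f : X → ℝ}
    (h : BddHolder β S f) (hβ : 0 < β) : ContinuousOn f S := by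
  obtain ⟨C, hC⟩ := h.exists_holderOnWith
  exact hC.continuousOn hβ

theorem Hol.contDiffOn (h : Hol β S k f) (hβ : 0 < β) (hS : UniqueDiffOn ℝ S) :
    ContDiffOn ℝ k f S := by
  induction k generalizing f with
  | zero => exact contDiffOn_zero.2 (BddHolder.continuousOn h hβ)
  | succ k ih =>
    obtain ⟨-, a, b, h1, h2, h3⟩ := h
    push_cast
    rw [contDiffOn_succ_iff_hasFDerivWithinAt_of_uniqueDiffOn hS]
    exact ⟨by simp, _, ((ih h2).smul contDiffOn_const).add ((ih h3).smul contDiffOn_const), h1⟩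

theorem fderivWithin_fderivWithin_apply (hf : ContDiffOn ℝ 2 f S) (hS : UniqueDiffOn ℝ S)
    {z : ℝ × ℝ} (hz : z ∈ S) (v w : ℝ × ℝ) :
    fderivWithin ℝ (fderivWithin ℝ f S) S z v w
      = fderivWithin ℝ (fun y => fderivWithin ℝ f S y w) S z v := by
  have h1 : DifferentiableWithinAt ℝ (fderivWithin ℝ f S) S z :=
    (((contDiffOn_succ_iff_fderivWithin (n := 1) hS).1 (by rwa [one_add_one_eq_two])).2.2.differentiableOn
      (by simp)) z hz
  rw [fderivWithin_clm_apply (hS z hz) h1 (differentiableWithinAt_const w)]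
  simp

/-- Partial derivatives are values of the iterated derivative at vectors of norm at most one, so
they inherit its Hölder constant. -/
theorem HolderClass.exists_hasGrad_one (h : HolderClass 1 β S f) (hS : UniqueDiffOn ℝ S) :
    HasGrad S f (d₁ S f) (d₂ S f) ∧ (∃ C : ℝ≥0, HolderOnWith C β (d₁ S f) S) ∧
      ∃ C : ℝ≥0, HolderOnWith C β (d₂ S f) S := by
  obtain ⟨h1, C, hC⟩ := h
  have h1' : ContDiffOn ℝ 1 f S := by exact_mod_cast h1
  have key : ∀ v : ℝ × ℝ, ‖v‖ ≤ 1 → HolderOnWith C β (fun z => fderivWithin ℝ f S z v) S := by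
    intro v hv
    refine holderOnWith_of_dist fun x hx y hy => ?_
    refine le_trans ?_ (hC.dist_le hx hy)
    have e : ∀ z ∈ S, fderivWithin ℝ f S z v = iteratedFDerivWithin ℝ 1 f S z ![v] :=
      fun z hz => by rw [iteratedFDerivWithin_one_apply (hS z hz)]; simp
    rw [e x hx, e y hy, dist_eq_norm, dist_eq_norm, ← sub_apply]
    refine (ContinuousMultilinearMap.le_opNorm _ _).trans (mul_le_of_le_one_right (norm_nonneg _) ?_)
    simpa using hv
  exact ⟨hasGrad_d₁_d₂ (h1'.differentiableOn (by simp)), ⟨C, key _ (by simp)⟩, ⟨C, key _ (by simp)⟩⟩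

theorem HolderClass.exists_hasGrad_two (h : HolderClass 2 β S f) (hS : UniqueDiffOn ℝ S) :
    HasGrad S f (d₁ S f) (d₂ S f) ∧
    (HasGrad S (d₁ S f) (d₁ S (d₁ S f)) (d₂ S (d₁ S f)) ∧
      (∃ C : ℝ≥0, HolderOnWith C β (d₁ S (d₁ S f)) S) ∧
      ∃ C : ℝ≥0, HolderOnWith C β (d₂ S (d₁ S f)) S) ∧
    (HasGrad S (d₂ S f) (d₁ S (d₂ S f)) (d₂ S (d₂ S f)) ∧
      (∃ C : ℝ≥0, HolderOnWith C β (d₁ S (d₂ S f)) S) ∧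
      ∃ C : ℝ≥0, HolderOnWith C β (d₂ S (d₂ S f)) S) := by
  obtain ⟨h1, C, hC⟩ := h
  have h1' : ContDiffOn ℝ 2 f S := by exact_mod_cast h1
  have key : ∀ v w : ℝ × ℝ, ‖v‖ ≤ 1 → ‖w‖ ≤ 1 →
      HolderOnWith C β (fun z => fderivWithin ℝ (fun y => fderivWithin ℝ f S y w) S z v) S := by
    intro v w hv hw
    refine holderOnWith_of_dist fun x hx y hy => ?_
    refine le_trans ?_ (hC.dist_le hx hy)
    have e : ∀ z ∈ S, fderivWithin ℝ (fun y => fderivWithin ℝ f S y w) S z v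
        = iteratedFDerivWithin ℝ 2 f S z ![v, w] := fun z hz => by
      rw [iteratedFDerivWithin_two_apply f hS hz, ← fderivWithin_fderivWithin_apply h1' hS hz]
      simp
    rw [e x hx, e y hy, dist_eq_norm, dist_eq_norm, ← sub_apply]
    refine (ContinuousMultilinearMap.le_opNorm _ _).trans (mul_le_of_le_one_right (norm_nonneg _) ?_)
    simp only [Fin.prod_univ_two]
    exact mul_le_one₀ hv (norm_nonneg _) hw
  have h2 : ContDiffOn ℝ 1 (fderivWithin ℝ f S) S :=
    ((contDiffOn_succ_iff_fderivWithin (n := 1) hS).1 (by rwa [one_add_one_eq_two])).2.2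
  have h3 : ∀ w : ℝ × ℝ, DifferentiableOn ℝ (fun y => fderivWithin ℝ f S y w) S := fun w =>
    (h2.differentiableOn (by simp)).clm_apply (differentiableOn_const w)
  exact ⟨hasGrad_d₁_d₂ (h1'.differentiableOn (by simp)),
    ⟨hasGrad_d₁_d₂ (h3 _), ⟨C, key _ _ (by simp) (by simp)⟩, ⟨C, key _ _ (by simp) (by simp)⟩⟩,
    ⟨hasGrad_d₁_d₂ (h3 _), ⟨C, key _ _ (by simp) (by simp)⟩, ⟨C, key _ _ (by simp) (by simp)⟩⟩⟩

theorem Hol.holderClass_one (h : Hol β S 1 f) (hβ : 0 < β) (hS : UniqueDiffOn ℝ S) :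
    HolderClass 1 β S f := by
  refine ⟨h.contDiffOn hβ hS, ?_⟩
  obtain ⟨-, a, b, h1, h2, h3⟩ := h
  obtain ⟨M, hM, -, hM2⟩ := h2
  obtain ⟨N, hN, -, hN2⟩ := h3
  refine exists_holderOnWith_of_dist (C := M + N) (by positivity) fun x hx y hy => ?_
  rw [dist_eq_norm]
  refine ContinuousMultilinearMap.opNorm_le_bound (by positivity) fun m => ?_
  rw [sub_apply, iteratedFDerivWithin_one_apply (hS x hx),
    iteratedFDerivWithin_one_apply (hS y hy), (h1 x hx).fderivWithin (hS x hx),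
    (h1 y hy).fderivWithin (hS y hy)]
  simp only [add_apply, smul_apply,
    ContinuousLinearMap.coe_fst', ContinuousLinearMap.coe_snd', smul_eq_mul, Fin.prod_univ_one,
    Real.norm_eq_abs]
  calc |a x * (m 0).1 + b x * (m 0).2 - (a y * (m 0).1 + b y * (m 0).2)|
      = |(a x - a y) * (m 0).1 + (b x - b y) * (m 0).2| := by ring_nf
    _ ≤ |a x - a y| * |(m 0).1| + |b x - b y| * |(m 0).2| := by
        rw [← abs_mul, ← abs_mul]; exact abs_add_le _ _
    _ ≤ M * dist x y ^ (β : ℝ) * ‖m 0‖ + N * dist x y ^ (β : ℝ) * ‖m 0‖ := by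
        have := hM2 x hx y hy
        have := hN2 x hx y hy
        have : |(m 0).1| ≤ ‖m 0‖ := norm_fst_le (m 0)
        have : |(m 0).2| ≤ ‖m 0‖ := norm_snd_le (m 0)
        gcongr
    _ = _ := by ring

theorem Hol.holderClass_two (h : Hol β S 2 f) (hβ : 0 < β) (hS : UniqueDiffOn ℝ S) :
    HolderClass 2 β S f := by
  have hc := h.contDiffOn hβ hS
  have hc' : ContDiffOn ℝ 2 f S := by exact_mod_cast hc
  refine ⟨hc, ?_⟩
  obtain ⟨-, a, b, h1, ⟨-, a₁, a₂, ha, ha1, ha2⟩, ⟨-, b₁, b₂, hb, hb1, hb2⟩⟩ := h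
  obtain ⟨A₁, hA₁, -, iA₁⟩ := ha1
  obtain ⟨A₂, hA₂, -, iA₂⟩ := ha2
  obtain ⟨B₁, hB₁, -, iB₁⟩ := hb1
  obtain ⟨B₂, hB₂, -, iB₂⟩ := hb2
  refine exists_holderOnWith_of_dist (C := A₁ + A₂ + B₁ + B₂) (by positivity) fun x hx y hy => ?_
  rw [dist_eq_norm]
  refine ContinuousMultilinearMap.opNorm_le_bound (by positivity) fun m => ?_
  -- The second derivative is expanded in the four second partials, whose Hölder constants then add
  -- up.
  have e : ∀ z ∈ S, iteratedFDerivWithin ℝ 2 f S z m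
      = (a₁ z * (m 0).1 + a₂ z * (m 0).2) * (m 1).1
        + (b₁ z * (m 0).1 + b₂ z * (m 0).2) * (m 1).2 := by
    intro z hz
    rw [iteratedFDerivWithin_two_apply f hS hz, clm_eq (fderivWithin ℝ (fderivWithin ℝ f S) S z _),
      fderivWithin_fderivWithin_apply hc' hS hz, fderivWithin_fderivWithin_apply hc' hS hz,
      fderivWithin_congr (f₁ := fun y => fderivWithin ℝ f S y (1, 0)) (h1.d₁_eq hS)
        (h1.d₁_eq hS hz),
      fderivWithin_congr (f₁ := fun y => fderivWithin ℝ f S y (0, 1)) (h1.d₂_eq hS)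
        (h1.d₂_eq hS hz),
      (ha z hz).fderivWithin (hS z hz), (hb z hz).fderivWithin (hS z hz)]
    simp
  rw [sub_apply, e x hx, e y hy]
  simp only [Fin.prod_univ_two, Real.norm_eq_abs]
  set D := dist x y ^ (β : ℝ)
  have i1 : |(m 0).1| ≤ ‖m 0‖ := norm_fst_le (m 0)
  have i2 : |(m 0).2| ≤ ‖m 0‖ := norm_snd_le (m 0)
  have j1 : |(m 1).1| ≤ ‖m 1‖ := norm_fst_le (m 1)
  have j2 : |(m 1).2| ≤ ‖m 1‖ := norm_snd_le (m 1)
  calc _ = |(a₁ x - a₁ y) * (m 0).1 * (m 1).1 + (a₂ x - a₂ y) * (m 0).2 * (m 1).1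
        + ((b₁ x - b₁ y) * (m 0).1 * (m 1).2 + (b₂ x - b₂ y) * (m 0).2 * (m 1).2)| := by ring_nf
    _ ≤ |a₁ x - a₁ y| * |(m 0).1| * |(m 1).1| + |a₂ x - a₂ y| * |(m 0).2| * |(m 1).1|
        + (|b₁ x - b₁ y| * |(m 0).1| * |(m 1).2| + |b₂ x - b₂ y| * |(m 0).2| * |(m 1).2|) := by
        simp only [← abs_mul]
        exact (abs_add_le _ _).trans (add_le_add (abs_add_le _ _) (abs_add_le _ _))
    _ ≤ A₁ * D * ‖m 0‖ * ‖m 1‖ + A₂ * D * ‖m 0‖ * ‖m 1‖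
        + (B₁ * D * ‖m 0‖ * ‖m 1‖ + B₂ * D * ‖m 0‖ * ‖m 1‖) := by
        have := iA₁ x hx y hy
        have := iA₂ x hx y hy
        have := iB₁ x hx y hy
        have := iB₂ x hx y hy
        gcongr
    _ = _ := by ring

end Hol

/-! ### Geometry and analysis of the closed fluid domain -/

/-- A `C¹`, `lam`-periodic surface profile lying above the bed `y = -d`. -/
structure Profile (lam d : ℝ) (η : ℝ → ℝ) : Prop where
  lam_pos : 0 < lam
  above : ∀ x, -d < η x
  smooth : ContDiff ℝ 1 η
  periodic : Function.Periodic η lam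

theorem exists_bound_of_periodic {lam : ℝ} (hlam : 0 < lam) {φ : ℝ → ℝ} (hφ : Continuous φ)
    (hp : Function.Periodic φ lam) : ∃ M, 0 ≤ M ∧ ∀ x, |φ x| ≤ M := by
  obtain ⟨M, hM⟩ := (isCompact_Icc (a := (0 : ℝ)) (b := lam)).exists_bound_of_continuousOn
    hφ.continuousOn
  have h : ∀ x, |φ x| ≤ M := fun x => by
    obtain ⟨y, hy, e⟩ := hp.exists_mem_Ico₀ hlam x
    rw [e]
    exact hM y (Ico_subset_Icc_self hy)
  exact ⟨M, (abs_nonneg _).trans (h 0), h⟩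

theorem periodic_deriv {lam : ℝ} {φ : ℝ → ℝ} (hp : Function.Periodic φ lam) :
    Function.Periodic (deriv φ) lam := by
  intro x
  rw [← deriv_comp_add_const]
  congr 1
  exact funext hp

namespace Profile

variable {lam d : ℝ} {η : ℝ → ℝ} {f a b g : ℝ × ℝ → ℝ} {β : ℝ≥0} {k : ℕ}

theorem hasDerivAt (D : Profile lam d η) (x : ℝ) : HasDerivAt η (deriv η x) x :=
  (D.smooth.differentiable (by simp) x).hasDerivAt

theorem continuous_deriv (D : Profile lam d η) : Continuous (deriv η) :=
  D.smooth.continuous_deriv le_rfl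

theorem depth_pos (D : Profile lam d η) (x : ℝ) : 0 < η x + d := by linarith [D.above x]

theorem bed_mem (D : Profile lam d η) (x : ℝ) : (x, -d) ∈ fluidBar d η := ⟨le_rfl, (D.above x).le⟩

theorem surface_mem (D : Profile lam d η) (x : ℝ) : (x, η x) ∈ fluidBar d η :=
  ⟨(D.above x).le, le_rfl⟩

theorem const {p : ℝ} (hlam : 0 < lam) (hp : p < 0) : Profile lam (-p) (fun _ => 0) :=
  ⟨hlam, fun _ => by simpa using hp, contDiff_const, fun _ => rfl⟩

theorem add_mem (D : Profile lam d η) {z : ℝ × ℝ} (hz : z ∈ fluidBar d η) :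
    (z.1 + lam, z.2) ∈ fluidBar d η := ⟨hz.1, (D.periodic z.1).symm ▸ hz.2⟩

theorem fluid_subset : fluid d η ⊆ fluidBar d η := fun _ hz => ⟨hz.1.le, hz.2.le⟩

theorem isOpen_fluid (D : Profile lam d η) : IsOpen (fluid d η) :=
  (isOpen_lt continuous_const continuous_snd).inter
    (isOpen_lt continuous_snd (D.smooth.continuous.comp continuous_fst))

theorem isClosed_fluidBar (D : Profile lam d η) : IsClosed (fluidBar d η) :=
  (isClosed_le continuous_const continuous_snd).inter
    (isClosed_le continuous_snd (D.smooth.continuous.comp continuous_fst))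

theorem fluidBar_subset_closure (D : Profile lam d η) : fluidBar d η ⊆ closure (fluid d η) := by
  intro z hz
  have h1 : z.2 ∈ closure (Ioo (-d) (η z.1)) := by
    rw [closure_Ioo (D.above z.1).ne]
    exact hz
  exact map_mem_closure (f := fun t => (z.1, t)) (by fun_prop) h1 fun t ht => ht

/-- Lets equations posed only in the open domain be used on the surface and the bed. -/
theorem eqOn_fluidBar (D : Profile lam d η) (hf : ContinuousOn f (fluidBar d η))
    (hg : ContinuousOn g (fluidBar d η)) (h : ∀ z ∈ fluid d η, f z = g z) :
    EqOn f g (fluidBar d η) :=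
  Set.EqOn.of_subset_closure h hf hg fluid_subset D.fluidBar_subset_closure

theorem relative_height_mem (D : Profile lam d η) {t : ℝ} (ht : t ∈ Icc (0 : ℝ) 1) (x : ℝ) :
    (x, -d + t * (η x + d)) ∈ fluidBar d η := by
  have := D.depth_pos x
  constructor
  · have := mul_nonneg ht.1 this.le
    simpa using this
  · have := mul_le_mul_of_nonneg_right ht.2 this.le
    simp only
    linarith

theorem exists_relative_height (D : Profile lam d η) {z : ℝ × ℝ} (hz : z ∈ fluidBar d η) :
    ∃ t ∈ Icc (0 : ℝ) 1, -d + t * (η z.1 + d) = z.2 := by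
  have := D.depth_pos z.1
  refine ⟨(z.2 + d) / (η z.1 + d), ⟨div_nonneg (by linarith [hz.1]) this.le, ?_⟩, ?_⟩
  · rw [div_le_one this]
    linarith [hz.2]
  · field_simp
    ring

/-- Periodicity of `f` is known only on the domain. Along a curve of constant relative height, `f`
becomes a periodic function on the whole line, which can be reduced to one period. -/
theorem exists_fundamental (D : Profile lam d η) {z : ℝ × ℝ} (hz : z ∈ fluidBar d η)
    (hf : PeriodicOn lam (fluidBar d η) f) :
    ∃ w ∈ fluidBar d η, w.1 ∈ Icc 0 lam ∧ f w = f z := by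
  obtain ⟨t, ht, e⟩ := D.exists_relative_height hz
  have hp : Function.Periodic (fun x => f (x, -d + t * (η x + d))) lam := fun x => by
    have := hf _ (D.relative_height_mem ht x)
    simp only [D.periodic x]
    exact this
  obtain ⟨y, hy, h⟩ := hp.exists_mem_Ico₀ D.lam_pos z.1
  simp only [e] at h
  exact ⟨_, D.relative_height_mem ht y, Ico_subset_Icc_self hy, h.symm⟩

theorem isCompact_period (D : Profile lam d η) :
    IsCompact {z ∈ fluidBar d η | z.1 ∈ Icc 0 lam} := by
  obtain ⟨M, -, hM⟩ := exists_bound_of_periodic D.lam_pos D.smooth.continuous D.periodic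
  refine IsCompact.of_isClosed_subset ((isCompact_Icc (a := (0 : ℝ)) (b := lam)).prod
    (isCompact_Icc (a := -d) (b := M)))
    (D.isClosed_fluidBar.inter (isClosed_Icc.preimage continuous_fst)) ?_
  rintro z ⟨hz, h⟩
  exact ⟨h, hz.1, hz.2.trans ((le_abs_self _).trans (hM _))⟩

theorem exists_bound (D : Profile lam d η) (hf : ContinuousOn f (fluidBar d η))
    (hp : PeriodicOn lam (fluidBar d η) f) : ∃ M, 0 ≤ M ∧ ∀ z ∈ fluidBar d η, |f z| ≤ M := by
  obtain ⟨M, hM⟩ := D.isCompact_period.exists_bound_of_continuousOn (hf.mono (sep_subset _ _))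
  have h : ∀ z ∈ fluidBar d η, |f z| ≤ M := fun z hz => by
    obtain ⟨w, hw, h1, h2⟩ := D.exists_fundamental hz hp
    rw [← h2]
    exact hM w ⟨hw, h1⟩
  exact ⟨M, (abs_nonneg _).trans (h _ (D.bed_mem 0)), h⟩

theorem exists_pos_lower_bound (D : Profile lam d η) (hf : ContinuousOn f (fluidBar d η))
    (hp : PeriodicOn lam (fluidBar d η) f) (h0 : ∀ z ∈ fluidBar d η, 0 < f z) :
    ∃ c, 0 < c ∧ ∀ z ∈ fluidBar d η, c ≤ f z := by
  obtain ⟨w, hw, h⟩ := D.isCompact_period.exists_isMinOn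
    ⟨(0, -d), D.bed_mem 0, le_rfl, D.lam_pos.le⟩ (hf.mono (sep_subset _ _))
  refine ⟨f w, h0 w hw.1, fun z hz => ?_⟩
  obtain ⟨v, hv, h1, h2⟩ := D.exists_fundamental hz hp
  rw [← h2]
  exact h ⟨hv, h1⟩

theorem hasGrad_relative_height (D : Profile lam d η) {S : Set (ℝ × ℝ)} :
    HasGrad S (fun z => -d + z.2 * (η z.1 + d)) (fun z => z.2 * deriv η z.1)
      (fun z => η z.1 + d) := by
  have h1 : HasGrad S (fun z => η z.1) (fun z => deriv η z.1 * 1) (fun z => deriv η z.1 * 0) :=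
    (hasGrad_fst (S := S)).comp_deriv (mapsTo_univ _ _)
      (fun x _ => (D.hasDerivAt x).hasDerivWithinAt)
  refine ((hasGrad_const (-d)).add (hasGrad_snd.mul (h1.add (hasGrad_const d)))).congr
    (fun _ _ => rfl) ?_ ?_ <;>
  · intro z _
    simp

/-- Straightening: the domain is the image of `ℝ × [0, 1]` under a differentiable map whose
derivative is onto, because the depth is positive. -/
theorem uniqueDiffOn (D : Profile lam d η) : UniqueDiffOn ℝ (fluidBar d η) := by
  have e : fluidBar d η
      = (fun z : ℝ × ℝ => (z.1, -d + z.2 * (η z.1 + d))) '' (univ ×ˢ Icc (0 : ℝ) 1) := by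
    ext z
    constructor
    · intro hz
      obtain ⟨t, ht, h⟩ := D.exists_relative_height hz
      exact ⟨(z.1, t), ⟨mem_univ _, ht⟩, by simp only [h]⟩
    · rintro ⟨w, hw, rfl⟩
      exact D.relative_height_mem hw.2 w.1
  rw [e]
  refine (uniqueDiffOn_univ.prod uniqueDiffOn_Icc_zero_one).image
    (fun z hz => (hasFDerivWithinAt_fst (𝕜 := ℝ)).prodMk (D.hasGrad_relative_height z hz))
    fun z hz => Function.Surjective.denseRange fun w => ?_
  have := (D.depth_pos z.1).ne'
  refine ⟨(w.1, (w.2 - z.2 * deriv η z.1 * w.1) / (η z.1 + d)), ?_⟩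
  ext
  · simp
  · simp
    field_simp
    ring

theorem hasDerivWithinAt_vertical (h : HasGrad (fluidBar d η) f a b) {x y : ℝ}
    (hy : y ∈ Icc (-d) (η x)) :
    HasDerivWithinAt (fun y => f (x, y)) (b (x, y)) (Icc (-d) (η x)) y := by
  simpa using h.hasDerivWithinAt_comp (hasDerivWithinAt_const y _ x) (hasDerivWithinAt_id y _) hy
    (fun t ht => ht)

theorem hasDerivAt_surface (D : Profile lam d η) (h : HasGrad (fluidBar d η) f a b) (x : ℝ) :
    HasDerivAt (fun x => f (x, η x)) (a (x, η x) + b (x, η x) * deriv η x) x := by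
  rw [← hasDerivWithinAt_univ]
  simpa using h.hasDerivWithinAt_comp (hasDerivWithinAt_id x univ)
    (D.hasDerivAt x).hasDerivWithinAt (mem_univ x) (fun t _ => D.surface_mem t)

theorem hasDerivAt_bed (D : Profile lam d η) (h : HasGrad (fluidBar d η) f a b) (x : ℝ) :
    HasDerivAt (fun x => f (x, -d)) (a (x, -d)) x := by
  rw [← hasDerivWithinAt_univ]
  simpa using h.hasDerivWithinAt_comp (hasDerivWithinAt_id x univ)
    (hasDerivWithinAt_const x univ (-d)) (mem_univ x) (fun t _ => D.bed_mem t)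

/-- A function whose gradient is bounded is Lipschitz continuous on the closed fluid domain. -/
theorem exists_lipschitz (D : Profile lam d η) (h : HasGrad (fluidBar d η) f a b) {A B : ℝ}
    (hA : ∀ z ∈ fluidBar d η, |a z| ≤ A) (hB : ∀ z ∈ fluidBar d η, |b z| ≤ B) :
    ∃ L, 0 ≤ L ∧ ∀ z ∈ fluidBar d η, ∀ w ∈ fluidBar d η,
      |f z - f w| ≤ L * dist z w := by
  obtain ⟨M, hM0, hM⟩ := exists_bound_of_periodic D.lam_pos D.continuous_deriv
    (periodic_deriv D.periodic)
  have hA0 : 0 ≤ A := (abs_nonneg _).trans (hA _ (D.bed_mem 0))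
  have hB0 : 0 ≤ B := (abs_nonneg _).trans (hB _ (D.bed_mem 0))
  -- The domain need not be convex. The path from `z` to `w` follows the curve of constant relative
  -- height through `z`, of slope at most `M`, and then the vertical through `w`, over a length at
  -- most `(M + 1) * dist z w`.
  refine ⟨A + B * M + B * (M + 1), by positivity, fun z hz w hw => ?_⟩
  obtain ⟨t, ht, e⟩ := D.exists_relative_height hz
  have hx : |z.1 - w.1| ≤ dist z w := by
    rw [← Real.dist_eq]; exact le_max_left _ _
  have hy : |z.2 - w.2| ≤ dist z w := by
    rw [← Real.dist_eq]; exact le_max_right _ _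
  have hηd : ∀ x, HasDerivWithinAt (fun x => -d + t * (η x + d)) (t * deriv η x) univ x := fun x =>
    ((((D.hasDerivAt x).add_const d).const_mul t).const_add (-d)).hasDerivWithinAt
  have htM : ∀ x, |t * deriv η x| ≤ M := fun x => by
    rw [abs_mul, abs_of_nonneg ht.1]
    exact (mul_le_of_le_one_left (abs_nonneg _) ht.2).trans (hM x)
  have s1 : |f (z.1, -d + t * (η z.1 + d)) - f (w.1, -d + t * (η w.1 + d))|
      ≤ (A + B * M) * |z.1 - w.1| := by
    refine Convex.norm_image_sub_le_of_norm_hasDerivWithin_le (s := univ)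
      (f := fun x => f (x, -d + t * (η x + d)))
      (fun x hx => h.hasDerivWithinAt_comp (hasDerivWithinAt_id x univ) (hηd x) hx
        fun x _ => D.relative_height_mem ht x) (fun x _ => ?_) convex_univ (mem_univ _) (mem_univ _)
    have hm := D.relative_height_mem ht x
    refine (norm_add_le _ _).trans (add_le_add ?_ ?_)
    · simpa using hA _ hm
    · rw [norm_mul]
      exact mul_le_mul (hB _ hm) (htM x) (norm_nonneg _) hB0
  have s2 : |f (w.1, -d + t * (η w.1 + d)) - f (w.1, w.2)|
      ≤ B * |(-d + t * (η w.1 + d)) - w.2| :=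
    Convex.norm_image_sub_le_of_norm_hasDerivWithin_le
      (f := fun y => f (w.1, y)) (fun y hy => hasDerivWithinAt_vertical h hy)
      (fun y hy => hB _ hy) (convex_Icc _ _) hw (D.relative_height_mem ht w.1)
  have s3 : |(-d + t * (η w.1 + d)) - (-d + t * (η z.1 + d))| ≤ M * |w.1 - z.1| :=
    Convex.norm_image_sub_le_of_norm_hasDerivWithin_le (s := univ)
      (fun x _ => hηd x) (fun x _ => htM x) convex_univ (mem_univ _) (mem_univ _)
  rw [e] at s1 s3
  have s4 : |(-d + t * (η w.1 + d)) - w.2| ≤ (M + 1) * dist z w := by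
    calc _ = |((-d + t * (η w.1 + d)) - z.2) + (z.2 - w.2)| := by ring_nf
      _ ≤ _ := abs_add_le _ _
      _ ≤ M * dist z w + dist z w := by
          refine add_le_add (s3.trans ?_) hy
          rw [abs_sub_comm]
          gcongr
      _ = _ := by ring
  calc |f z - f w| = |(f (z.1, z.2) - f (w.1, -d + t * (η w.1 + d)))
        + (f (w.1, -d + t * (η w.1 + d)) - f (w.1, w.2))| := by simp
    _ ≤ _ := abs_add_le _ _
    _ ≤ (A + B * M) * dist z w + B * ((M + 1) * dist z w) := by
        refine add_le_add (s1.trans (by gcongr)) (s2.trans (by gcongr))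
    _ = _ := by ring

theorem hasGrad_translate (D : Profile lam d η) (h : HasGrad (fluidBar d η) f a b) :
    HasGrad (fluidBar d η) (fun z => f (z.1 + lam, z.2)) (fun z => a (z.1 + lam, z.2))
      (fun z => b (z.1 + lam, z.2)) := by
  intro z hz
  have h1 : HasFDerivWithinAt (fun z : ℝ × ℝ => (z.1 + lam, z.2))
      ((ContinuousLinearMap.fst ℝ ℝ ℝ).prod (ContinuousLinearMap.snd ℝ ℝ ℝ)) (fluidBar d η) z :=
    ((hasFDerivWithinAt_fst (𝕜 := ℝ)).add_const lam).prodMk hasFDerivWithinAt_snd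
  refine ((h _ (D.add_mem hz)).comp z h1 fun w hw => D.add_mem hw).congr_fderiv ?_
  ext <;> simp

theorem periodicOn_grad (D : Profile lam d η) (h : HasGrad (fluidBar d η) f a b)
    (hp : PeriodicOn lam (fluidBar d η) f) :
    PeriodicOn lam (fluidBar d η) a ∧ PeriodicOn lam (fluidBar d η) b := by
  have := ((D.hasGrad_translate h).congr (fun z hz => (hp z hz).symm) (fun _ _ => rfl)
    (fun _ _ => rfl)).unique h D.uniqueDiffOn
  exact ⟨fun z hz => this.1 hz, fun z hz => this.2 hz⟩

/-- A function with continuous periodic gradient is bounded and Hölder continuous. -/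
theorem bddHolder_of_hasGrad (D : Profile lam d η) (hβ : β < 1) (h : HasGrad (fluidBar d η) f a b)
    (hp : PeriodicOn lam (fluidBar d η) f) (ha : ContinuousOn a (fluidBar d η))
    (hb : ContinuousOn b (fluidBar d η)) : BddHolder β (fluidBar d η) f := by
  obtain ⟨pa, pb⟩ := D.periodicOn_grad h hp
  obtain ⟨A, -, hA⟩ := D.exists_bound ha pa
  obtain ⟨B, -, hB⟩ := D.exists_bound hb pb
  obtain ⟨M, -, hM⟩ := D.exists_bound h.continuousOn hp
  obtain ⟨L, -, hL⟩ := D.exists_lipschitz h hA hB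
  exact BddHolder.of_lipschitz hβ hM hL

theorem hol_succ (D : Profile lam d η) (hβ₀ : 0 < β) (hβ : β < 1)
    (h : HasGrad (fluidBar d η) f a b)
    (hp : PeriodicOn lam (fluidBar d η) f) (ha : Hol β (fluidBar d η) k a)
    (hb : Hol β (fluidBar d η) k b) : Hol β (fluidBar d η) (k + 1) f :=
  ⟨D.bddHolder_of_hasGrad hβ h hp (ha.bddHolder.continuousOn hβ₀) (hb.bddHolder.continuousOn hβ₀),
    a, b, h, ha, hb⟩

theorem exists_lipschitz_of_hol (D : Profile lam d η) (h : Hol β (fluidBar d η) 1 f) :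
    ∃ L, ∀ z ∈ fluidBar d η, ∀ w ∈ fluidBar d η, |f z - f w| ≤ L * dist z w := by
  obtain ⟨-, a, b, h1, ⟨A, -, hA, -⟩, ⟨B, -, hB, -⟩⟩ := h
  obtain ⟨L, -, hL⟩ := D.exists_lipschitz h1 hA hB
  exact ⟨L, hL⟩

theorem bddHolder_of_holderOnWith (D : Profile lam d η) (hβ₀ : 0 < β)
    (hp : PeriodicOn lam (fluidBar d η) f) (h : ∃ C : ℝ≥0, HolderOnWith C β f (fluidBar d η)) :
    BddHolder β (fluidBar d η) f := by
  obtain ⟨C, hC⟩ := h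
  obtain ⟨M, -, hM⟩ := D.exists_bound (hC.continuousOn hβ₀) hp
  exact BddHolder.of_holderOnWith hC hM

theorem hol_one (D : Profile lam d η) (hβ₀ : 0 < β) (hβ : β < 1)
    (h : HolderClass 1 β (fluidBar d η) f) (hp : PeriodicOn lam (fluidBar d η) f) :
    Hol β (fluidBar d η) 1 f := by
  obtain ⟨h1, h2, h3⟩ := h.exists_hasGrad_one D.uniqueDiffOn
  obtain ⟨pa, pb⟩ := D.periodicOn_grad h1 hp
  exact D.hol_succ hβ₀ hβ h1 hp (D.bddHolder_of_holderOnWith hβ₀ pa h2)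
    (D.bddHolder_of_holderOnWith hβ₀ pb h3)

theorem hol_two (D : Profile lam d η) (hβ₀ : 0 < β) (hβ : β < 1)
    (h : HolderClass 2 β (fluidBar d η) f) (hp : PeriodicOn lam (fluidBar d η) f) :
    Hol β (fluidBar d η) 2 f := by
  obtain ⟨h1, ⟨ha, ha1, ha2⟩, ⟨hb, hb1, hb2⟩⟩ := h.exists_hasGrad_two D.uniqueDiffOn
  obtain ⟨pa, pb⟩ := D.periodicOn_grad h1 hp
  obtain ⟨paa, pab⟩ := D.periodicOn_grad ha pa
  obtain ⟨pba, pbb⟩ := D.periodicOn_grad hb pb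
  exact D.hol_succ hβ₀ hβ h1 hp
    (D.hol_succ hβ₀ hβ ha pa (D.bddHolder_of_holderOnWith hβ₀ paa ha1)
      (D.bddHolder_of_holderOnWith hβ₀ pab ha2))
    (D.hol_succ hβ₀ hβ hb pb (D.bddHolder_of_holderOnWith hβ₀ pba hb1)
      (D.bddHolder_of_holderOnWith hβ₀ pbb hb2))

/-- Symmetry of the second derivatives, up to the boundary. -/
theorem mixed_eq (D : Profile lam d η) (h : ContDiffOn ℝ 2 f (fluidBar d η))
    {a₁ a₂ b₁ b₂ : ℝ × ℝ → ℝ} (hf : HasGrad (fluidBar d η) f a b)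
    (ha : HasGrad (fluidBar d η) a a₁ a₂) (hb : HasGrad (fluidBar d η) b b₁ b₂) :
    EqOn a₂ b₁ (fluidBar d η) := by
  intro z hz
  have hS := D.uniqueDiffOn
  -- Second derivatives within a set are symmetric at limits of interior points, and boundary points
  -- of the domain are such limits.
  have hint : z ∈ closure (interior (fluidBar d η)) :=
    closure_mono (interior_maximal fluid_subset D.isOpen_fluid) (D.fluidBar_subset_closure hz)
  have hs := (h z hz).isSymmSndFDerivWithinAt (by simp) hS hint hz
  have := hs (0, 1) (1, 0)
  rw [fderivWithin_fderivWithin_apply h hS hz, fderivWithin_fderivWithin_apply h hS hz] at this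
  have e1 : d₂ (fluidBar d η) (d₁ (fluidBar d η) f) z = a₂ z :=
    (d₂_congr (hf.d₁_eq hS) hz).trans (ha.d₂_eq hS hz)
  have e2 : d₁ (fluidBar d η) (d₂ (fluidBar d η) f) z = b₁ z :=
    (d₁_congr (hf.d₂_eq hS) hz).trans (hb.d₁_eq hS hz)
  rw [← e1, ← e2]
  exact this

/-- Two functions with the same vertical derivative that agree on the surface are equal. -/
theorem eqOn_of_vertical {a' b' : ℝ × ℝ → ℝ} (hf : HasGrad (fluidBar d η) f a b)
    (hg : HasGrad (fluidBar d η) g a' b') (hb : EqOn b b' (fluidBar d η))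
    (hs : ∀ x, f (x, η x) = g (x, η x)) : EqOn f g (fluidBar d η) := by
  intro z hz
  have := Convex.norm_image_sub_le_of_norm_hasDerivWithin_le (C := 0)
    (f := fun y => f (z.1, y) - g (z.1, y))
    (fun y hy => hasDerivWithinAt_vertical (hf.sub hg) hy)
    (fun y hy => by simp [hb (show (z.1, y) ∈ fluidBar d η from hy)]) (convex_Icc _ _)
    (x := η z.1) (y := z.2) ⟨hz.1.trans hz.2, le_rfl⟩ hz
  simpa [hs, sub_eq_zero] using this

end Profile

/-! ### Inversion in the vertical variable -/

/-- The linear map with matrix `(1, 0; a, b)`, `b ≠ 0`. -/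
noncomputable def shearEquiv (a b : ℝ) (hb : b ≠ 0) : (ℝ × ℝ) ≃L[ℝ] ℝ × ℝ :=
  ContinuousLinearEquiv.equivOfInverse
    ((ContinuousLinearMap.fst ℝ ℝ ℝ).prod
      (a • ContinuousLinearMap.fst ℝ ℝ ℝ + b • ContinuousLinearMap.snd ℝ ℝ ℝ))
    ((ContinuousLinearMap.fst ℝ ℝ ℝ).prod
      (-(a * b⁻¹) • ContinuousLinearMap.fst ℝ ℝ ℝ + b⁻¹ • ContinuousLinearMap.snd ℝ ℝ ℝ))
    (fun z => by ext <;> simp; field_simp; ring)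
    (fun z => by ext <;> simp; field_simp; ring)

theorem shearEquiv_symm_apply (a b : ℝ) (hb : b ≠ 0) (z : ℝ × ℝ) :
    (shearEquiv a b hb).symm z = (z.1, -(a * b⁻¹) * z.1 + b⁻¹ * z.2) := rfl

/-- `k` is the inverse of `f` in the second variable: `z ↦ (z.1, f z)` maps `S` onto `T`, and
`z ↦ (z.1, k z)` maps `T` back onto `S`. -/
structure IsVerticalInverse (S T : Set (ℝ × ℝ)) (f k : ℝ × ℝ → ℝ) : Prop where
  mem : ∀ z ∈ S, (z.1, f z) ∈ T
  mem_symm : ∀ z ∈ T, (z.1, k z) ∈ S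
  left : ∀ z ∈ S, k (z.1, f z) = z.2
  right : ∀ z ∈ T, f (z.1, k z) = z.2

namespace IsVerticalInverse

variable {S T : Set (ℝ × ℝ)} {f k a b : ℝ × ℝ → ℝ}

/-- The derivative of `z ↦ (z.1, f z)` is an invertible shear since `b ≠ 0`. Given continuity of
`k`, the inverse map is differentiable within `T`, hence also at boundary points. -/
theorem hasGrad (h : IsVerticalInverse S T f k) (hf : HasGrad S f a b) (hb : ∀ z ∈ S, b z ≠ 0)
    (hk : ContinuousOn k T) :
    HasGrad T k (fun z => -(a (z.1, k z) * (b (z.1, k z))⁻¹)) (fun z => (b (z.1, k z))⁻¹) := by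
  intro z hz
  have hz' := h.mem_symm z hz
  have hF : HasFDerivWithinAt (fun z : ℝ × ℝ => (z.1, f z))
      (shearEquiv (a (z.1, k z)) (b (z.1, k z)) (hb _ hz') : ℝ × ℝ →L[ℝ] ℝ × ℝ) S (z.1, k z) :=
    (hasFDerivWithinAt_fst (𝕜 := ℝ)).prodMk (hf _ hz')
  have hK : Tendsto (fun z : ℝ × ℝ => (z.1, k z)) (𝓝[T] z) (𝓝[S] (z.1, k z)) :=
    (continuousWithinAt_fst.prodMk (hk z hz)).tendsto_nhdsWithin h.mem_symm
  have := HasFDerivWithinAt.of_local_left_inverse (g := fun z : ℝ × ℝ => (z.1, k z)) hK hF hz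
    (eventually_nhdsWithin_of_forall fun w hw => by simp [h.right w hw])
  refine ((hasFDerivAt_snd (𝕜 := ℝ)).comp_hasFDerivWithinAt z this).congr_fderiv ?_
  ext <;> simp [shearEquiv_symm_apply]

/-- `f` carries bed to bed and surface to surface, so an interior point comes from neither. Needed
since the differential equations hold in the open domains. -/
theorem mem_fluid {d₁ d₂ : ℝ} {η₁ η₂ : ℝ → ℝ}
    (h : IsVerticalInverse (fluidBar d₁ η₁) (fluidBar d₂ η₂) f k) (bed : ∀ x, f (x, -d₁) = -d₂)
    (surface : ∀ x, f (x, η₁ x) = η₂ x) {z : ℝ × ℝ} (hz : z ∈ fluid d₂ η₂) :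
    (z.1, k z) ∈ fluid d₁ η₁ := by
  have hz' : z ∈ fluidBar d₂ η₂ := ⟨hz.1.le, hz.2.le⟩
  have h1 := h.mem_symm z hz'
  have h2 := h.right z hz'
  refine ⟨h1.1.lt_of_ne fun e => hz.1.ne ?_, h1.2.lt_of_ne fun e => hz.2.ne ?_⟩
  · rw [← h2, ← bed z.1, e]
  · rw [← h2, ← surface z.1]
    simp only at e
    rw [e]

end IsVerticalInverse

namespace Profile

variable {lam d₁ d₂ : ℝ} {η₁ η₂ : ℝ → ℝ} {f a b : ℝ × ℝ → ℝ} {β : ℝ≥0}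

/-- `f - c y` is nondecreasing along each vertical. -/
theorem mul_sub_le_vertical {d : ℝ} {η : ℝ → ℝ} (h : HasGrad (fluidBar d η) f a b) {c : ℝ}
    (hc : ∀ z ∈ fluidBar d η, c ≤ b z) {x y y' : ℝ} (hy : y ∈ Icc (-d) (η x))
    (hy' : y' ∈ Icc (-d) (η x)) (hyy : y ≤ y') : c * (y' - y) ≤ f (x, y') - f (x, y) := by
  have hd : ∀ t ∈ Icc (-d) (η x), HasDerivWithinAt (fun t => f (x, t) - c * t) (b (x, t) - c * 1)
      (Icc (-d) (η x)) t := fun t ht =>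
    (hasDerivWithinAt_vertical h ht).sub ((hasDerivWithinAt_id t _).const_mul c)
  have := monotoneOn_of_hasDerivWithinAt_nonneg (convex_Icc (-d) (η x))
    (fun t ht => (hd t ht).continuousWithinAt)
    (fun t ht => (hd t (interior_subset ht)).mono interior_subset)
    (fun t ht => by
      have := hc (x, t) (interior_subset ht : t ∈ Icc (-d) (η x))
      linarith) hy hy' hyy
  simp only at this
  linarith

theorem mul_abs_sub_le_vertical {d : ℝ} {η : ℝ → ℝ} (h : HasGrad (fluidBar d η) f a b) {c : ℝ}
    (hc : ∀ z ∈ fluidBar d η, c ≤ b z) {x y y' : ℝ} (hy : y ∈ Icc (-d) (η x))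
    (hy' : y' ∈ Icc (-d) (η x)) : c * |y' - y| ≤ |f (x, y') - f (x, y)| := by
  rcases le_total y y' with hyy | hyy
  · rw [abs_of_nonneg (sub_nonneg.2 hyy)]
    exact (mul_sub_le_vertical h hc hy hy' hyy).trans (le_abs_self _)
  · rw [abs_sub_comm, abs_of_nonneg (sub_nonneg.2 hyy), abs_sub_comm]
    exact (mul_sub_le_vertical h hc hy' hy hyy).trans (le_abs_self _)

/-- A `C^{2+β}` function that is strictly increasing in the second variable and takes prescribed
values at the bed and at the surface has a `C^{2+β}` inverse in the second variable. -/
theorem exists_verticalInverse (D₁ : Profile lam d₁ η₁) (D₂ : Profile lam d₂ η₂) (hβ₀ : 0 < β)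
    (hβ : β < 1) (hf : HasGrad (fluidBar d₁ η₁) f a b) (hf2 : Hol β (fluidBar d₁ η₁) 2 f)
    (hp : PeriodicOn lam (fluidBar d₁ η₁) f) (hb : ∀ z ∈ fluidBar d₁ η₁, 0 < b z)
    (bed : ∀ x, f (x, -d₁) = -d₂) (surface : ∀ x, f (x, η₁ x) = η₂ x) :
    ∃ k, IsVerticalInverse (fluidBar d₁ η₁) (fluidBar d₂ η₂) f k ∧
      PeriodicOn lam (fluidBar d₂ η₂) k ∧ Hol β (fluidBar d₂ η₂) 2 k ∧
      HasGrad (fluidBar d₂ η₂) k (fun z => -(a (z.1, k z) * (b (z.1, k z))⁻¹))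
        (fun z => (b (z.1, k z))⁻¹) := by
  obtain ⟨ha1, hb1⟩ := hf2.grad D₁.uniqueDiffOn hf
  obtain ⟨pa, pb⟩ := D₁.periodicOn_grad hf hp
  have hac := ha1.bddHolder.continuousOn hβ₀
  have hbc := hb1.bddHolder.continuousOn hβ₀
  obtain ⟨c, hc0, hc⟩ := D₁.exists_pos_lower_bound hbc pb hb
  obtain ⟨A, -, hA⟩ := D₁.exists_bound hac pa
  obtain ⟨B, -, hB⟩ := D₁.exists_bound hbc pb
  obtain ⟨L, hL0, hL⟩ := D₁.exists_lipschitz hf hA hB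
  have hex : ∀ z ∈ fluidBar d₂ η₂, ∃ y, (z.1, y) ∈ fluidBar d₁ η₁ ∧ f (z.1, y) = z.2 := by
    intro z hz
    have := intermediate_value_Icc (D₁.above z.1).le (f := fun y => f (z.1, y))
      (fun y hy => (hasDerivWithinAt_vertical hf hy).continuousWithinAt)
    rw [bed, surface] at this
    obtain ⟨y, hy, e⟩ := this hz
    exact ⟨y, hy, e⟩
  have hinj : ∀ {x y y'}, (x, y) ∈ fluidBar d₁ η₁ → (x, y') ∈ fluidBar d₁ η₁ →
      f (x, y) = f (x, y') → y = y' := by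
    intro x y y' hy hy' e
    have := mul_abs_sub_le_vertical hf hc hy hy'
    rw [e, sub_self, abs_zero] at this
    have h0 : |y' - y| ≤ 0 := by
      by_contra! h
      nlinarith
    linarith [abs_nonpos_iff.1 h0]
  choose! k hk1 hk2 using hex
  have hmem : ∀ z ∈ fluidBar d₁ η₁, (z.1, f z) ∈ fluidBar d₂ η₂ := by
    intro z hz
    have h1 := mul_sub_le_vertical hf hc (D₁.bed_mem z.1) hz hz.1
    have h2 := mul_sub_le_vertical hf hc hz (D₁.surface_mem z.1) hz.2
    rw [bed] at h1
    rw [surface] at h2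
    have := mul_nonneg hc0.le (sub_nonneg.2 hz.1)
    have := mul_nonneg hc0.le (sub_nonneg.2 hz.2)
    constructor <;> simp only <;> linarith
  have hV : IsVerticalInverse (fluidBar d₁ η₁) (fluidBar d₂ η₂) f k :=
    ⟨hmem, hk1, fun z hz => hinj (hk1 _ (hmem z hz)) hz (hk2 _ (hmem z hz)), hk2⟩
  -- Moving horizontally to the vertical through `w` changes `f` by at most `L` times the distance,
  -- and on that vertical `f` grows at rate at least `c`.
  have hLk' : ∀ z ∈ fluidBar d₂ η₂, ∀ w ∈ fluidBar d₂ η₂, (w.1, k z) ∈ fluidBar d₁ η₁ →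
      |k z - k w| ≤ (1 + L) / c * dist z w := by
    intro z hz w hw hm
    have h1 := mul_abs_sub_le_vertical hf hc (hk1 w hw) hm
    have h2 := hL _ hm _ (hk1 z hz)
    rw [hk2 z hz] at h2
    rw [hk2 w hw] at h1
    have e1 : dist (w.1, k z) (z.1, k z) = |z.1 - w.1| := by
      rw [Prod.dist_eq, dist_self, Real.dist_eq, abs_sub_comm]
      exact max_eq_left (abs_nonneg _)
    have hx : |z.1 - w.1| ≤ dist z w := by
      rw [← Real.dist_eq]; exact le_max_left _ _
    have hy : |z.2 - w.2| ≤ dist z w := by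
      rw [← Real.dist_eq]; exact le_max_right _ _
    rw [e1] at h2
    rw [div_mul_eq_mul_div, le_div_iff₀ hc0, mul_comm]
    calc c * |k z - k w| ≤ |f (w.1, k z) - w.2| := h1
      _ = |(f (w.1, k z) - z.2) + (z.2 - w.2)| := by ring_nf
      _ ≤ _ := abs_add_le _ _
      _ ≤ L * dist z w + dist z w := add_le_add (h2.trans (by gcongr)) hy
      _ = _ := by ring
  have hLk : ∀ z ∈ fluidBar d₂ η₂, ∀ w ∈ fluidBar d₂ η₂,
      |k z - k w| ≤ (1 + L) / c * dist z w := by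
    intro z hz w hw
    -- The horizontal move stays in the domain if it goes towards the higher surface.
    rcases le_total (η₁ z.1) (η₁ w.1) with h | h
    · exact hLk' z hz w hw ⟨(hk1 z hz).1, (hk1 z hz).2.trans h⟩
    · rw [abs_sub_comm, dist_comm]
      exact hLk' w hw z hz ⟨(hk1 w hw).1, (hk1 w hw).2.trans h⟩
  have hkp : PeriodicOn lam (fluidBar d₂ η₂) k := by
    intro z hz
    have h1 := hk1 z hz
    have h2 := D₁.add_mem h1
    refine hinj (hk1 _ (D₂.add_mem hz)) h2 ?_
    have := hp _ h1
    simp only at this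
    rw [this, hk2 z hz]
    exact hk2 _ (D₂.add_mem hz)
  have hkl : LipschitzOnWith ((1 + L) / c).toNNReal k (fluidBar d₂ η₂) :=
    LipschitzOnWith.of_dist_le_mul fun z hz w hw => by
      rw [Real.coe_toNNReal _ (by positivity)]
      exact hLk z hz w hw
  have hkg := hV.hasGrad hf (fun z hz => (hb z hz).ne') hkl.continuousOn
  obtain ⟨M, -, hM⟩ := D₂.exists_bound hkl.continuousOn hkp
  -- Bootstrap: the gradient of `k` is built from `a` and `b` at `(x, k)`, so each pass gains one
  -- derivative. Two passes start from the Lipschitz bound.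
  have hreg : ∀ j : ℕ, Hol β (fluidBar d₂ η₂) j k → Hol β (fluidBar d₁ η₁) j a →
      Hol β (fluidBar d₁ η₁) j b → Hol β (fluidBar d₂ η₂) (j + 1) k := by
    intro j hj haj hbj
    have hinv := (hbj.comp_graph hj hk1 hLk).inv hc0
      fun z hz => (hc _ (hk1 z hz)).trans (le_abs_self _)
    exact D₂.hol_succ hβ₀ hβ hkg hkp (((haj.comp_graph hj hk1 hLk).mul hinv).neg) hinv
  exact ⟨k, hV, hkp, hreg 1 (hreg 0 (BddHolder.of_lipschitz hβ hM hLk) ha1.of_succ hb1.of_succ)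
    ha1 hb1, hkg⟩

end Profile

/-- Second derivatives of a vertical inverse. -/
theorem IsVerticalInverse.hasGrad_grad {S T : Set (ℝ × ℝ)} {f k a b a₁ a₂ b₁ b₂ : ℝ × ℝ → ℝ}
    (h : IsVerticalInverse S T f k)
    (hk : HasGrad T k (fun z => -(a (z.1, k z) * (b (z.1, k z))⁻¹)) (fun z => (b (z.1, k z))⁻¹))
    (ha : HasGrad S a a₁ a₂) (hb : HasGrad S b b₁ b₂) (hb0 : ∀ z ∈ S, b z ≠ 0) :
    (∃ kxx kxy, HasGrad T (fun z => -(a (z.1, k z) * (b (z.1, k z))⁻¹)) kxx kxy ∧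
      (∀ z ∈ T, kxx z = -((a₁ (z.1, k z) - a₂ (z.1, k z) * a (z.1, k z) / b (z.1, k z))
          * b (z.1, k z) - a (z.1, k z) *
          (b₁ (z.1, k z) - b₂ (z.1, k z) * a (z.1, k z) / b (z.1, k z))) / b (z.1, k z) ^ 2) ∧
      ∀ z ∈ T, kxy z = -(a₂ (z.1, k z) * b (z.1, k z) - a (z.1, k z) * b₂ (z.1, k z))
        / b (z.1, k z) ^ 3) ∧
    ∃ kyx kyy, HasGrad T (fun z => (b (z.1, k z))⁻¹) kyx kyy ∧
      ∀ z ∈ T, kyy z = -b₂ (z.1, k z) / b (z.1, k z) ^ 3 := by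
  have ha' := ha.comp_graph hk h.mem_symm
  have hb' := (hb.comp_graph hk h.mem_symm).inv (fun z hz => hb0 _ (h.mem_symm z hz))
  refine ⟨⟨_, _, (ha'.mul hb').neg, fun z hz => ?_, fun z hz => ?_⟩, _, _, hb', fun z hz => ?_⟩ <;>
  · have := hb0 _ (h.mem_symm z hz)
    field_simp
    try ring

/-! ### The bending force and its mean -/

theorem arc_pos (η : ℝ → ℝ) (x : ℝ) : 0 < arc η x := Real.sqrt_pos.2 (by positivity)

theorem arc_sq (η : ℝ → ℝ) (x : ℝ) : arc η x ^ 2 = 1 + deriv η x ^ 2 :=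
  Real.sq_sqrt (by positivity)

section Bending

variable {η : ℝ → ℝ} {lam : ℝ}

theorem contDiff_deriv_of_four (h : ContDiff ℝ 4 η) : ContDiff ℝ 3 (deriv η) := by
  have : ContDiff ℝ (3 + 1) η := by
    convert h using 1
    norm_num
  exact (contDiff_succ_iff_deriv.1 this).2.2

theorem contDiff_arc (h : ContDiff ℝ 4 η) : ContDiff ℝ 3 (arc η) :=
  (contDiff_const.add ((contDiff_deriv_of_four h).pow 2)).sqrt fun x => by positivity

theorem contDiff_deriv_deriv (h : ContDiff ℝ 4 η) : ContDiff ℝ 2 (deriv (deriv η)) := by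
  have : ContDiff ℝ (2 + 1) (deriv η) := by
    convert contDiff_deriv_of_four h using 1
    norm_num
  exact (contDiff_succ_iff_deriv.1 this).2.2

theorem contDiff_curv (h : ContDiff ℝ 4 η) : ContDiff ℝ 2 (curv η) :=
  ((((contDiff_arc h).of_le (by norm_num)).pow 3).inv fun x => (pow_pos (arc_pos η x) 3).ne').mul
    (contDiff_deriv_deriv h)

theorem contDiff_deriv_curv (h : ContDiff ℝ 4 η) : ContDiff ℝ 1 (deriv (curv η)) := by
  have : ContDiff ℝ (1 + 1) (curv η) := by
    convert contDiff_curv h using 1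
    norm_num
  exact (contDiff_succ_iff_deriv.1 this).2.2

theorem contDiff_deriv_curv_arc (h : ContDiff ℝ 4 η) :
    ContDiff ℝ 1 (fun s => (arc η s)⁻¹ * deriv (curv η) s) :=
  (((contDiff_arc h).of_le (by norm_num)).inv fun x => (arc_pos η x).ne').mul
    (contDiff_deriv_curv h)

theorem continuous_bending (h : ContDiff ℝ 4 η) : Continuous (bending η) := by
  have h1 : Continuous (fun x => (arc η x)⁻¹) :=
    (contDiff_arc h).continuous.inv₀ fun x => (arc_pos η x).ne'
  have h2 := (contDiff_deriv_curv_arc h).continuous_deriv le_rfl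
  exact (h1.mul h2).add (continuous_const.mul ((contDiff_curv h).continuous.pow 3))

theorem hasDerivAt_arc (h : ContDiff ℝ 4 η) (x : ℝ) :
    HasDerivAt (arc η) (deriv η x * deriv (deriv η) x / arc η x) x := by
  have h1 : HasDerivAt (deriv η) (deriv (deriv η) x) x :=
    ((contDiff_deriv_of_four h).differentiable (by norm_num) x).hasDerivAt
  have h2 := ((h1.pow 2).const_add 1).sqrt (show 1 + deriv η x ^ 2 ≠ 0 by positivity)
  refine h2.congr_deriv ?_
  have := (arc_pos η x).ne'
  rw [Pi.pow_apply, show Real.sqrt (1 + deriv η x ^ 2) = arc η x from rfl]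
  field_simp
  simp
  ring

/-- The bending force of a plate is the derivative of the function
`ω⁻² κ' + κ² η' ω⁻¹ / 2`, where `κ` is the curvature. -/
theorem hasDerivAt_bending (h : ContDiff ℝ 4 η) (x : ℝ) :
    HasDerivAt (fun s => (arc η s)⁻¹ * ((arc η s)⁻¹ * deriv (curv η) s)
      + 1 / 2 * (curv η s ^ 2 * (deriv η s * (arc η s)⁻¹))) (bending η x) x := by
  have hω := (arc_pos η x).ne'
  have h0 := hasDerivAt_arc h x
  have h1 : HasDerivAt (deriv η) (deriv (deriv η) x) x :=
    ((contDiff_deriv_of_four h).differentiable (by norm_num) x).hasDerivAt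
  have h2 : HasDerivAt (curv η) (deriv (curv η) x) x :=
    ((contDiff_curv h).differentiable (by norm_num) x).hasDerivAt
  have h3 := ((contDiff_deriv_curv_arc h).differentiable (by norm_num) x).hasDerivAt
  have h4 := h0.inv hω
  refine ((h4.mul h3).add (((h2.pow 2).mul (h1.mul h4)).const_mul (1 / 2))).congr_deriv ?_
  -- Substituting `η'' = ω³κ` gives `ω' = η'ω²κ` and `(η'/ω)' = κ`: the terms in `κκ'η'` cancel and
  -- `κ³/2` remains.
  have e : deriv (deriv η) x = arc η x ^ 3 * curv η x := by
    rw [curv]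
    field_simp
  have hs : deriv η x ^ 2 = arc η x ^ 2 - 1 := by rw [arc_sq]; ring
  simp only [bending, Pi.inv_apply, Pi.pow_apply, Pi.mul_apply, e]
  field_simp
  ring_nf
  rw [hs]
  ring

theorem arc_periodic (hp : Function.Periodic η lam) : Function.Periodic (arc η) lam := fun x => by
  rw [arc, arc, periodic_deriv hp]

theorem curv_periodic (hp : Function.Periodic η lam) : Function.Periodic (curv η) lam := fun x => by
  rw [curv, curv, arc_periodic hp, periodic_deriv (periodic_deriv hp)]

/-- The primitive found above is built from `ω`, `κ`, `κ'` and `η'`, hence is periodic. -/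
theorem integral_bending (h : ContDiff ℝ 4 η) (hp : Function.Periodic η lam) :
    ∫ x in (0 : ℝ)..lam, bending η x = 0 := by
  rw [intervalIntegral.integral_eq_sub_of_hasDerivAt (fun x _ => hasDerivAt_bending h x)
    ((continuous_bending h).intervalIntegrable _ _), sub_eq_zero]
  have h1 := arc_periodic hp 0
  have h2 := curv_periodic hp 0
  have h3 := periodic_deriv (curv_periodic hp) 0
  have h4 := periodic_deriv hp 0
  rw [zero_add] at h1 h2 h3 h4
  rw [h1, h2, h3, h4]

/-- The mean value of the Bernoulli equation. -/
theorem integral_of_bernoulli {α g C : ℝ} {q : ℝ → ℝ} (h : ContDiff ℝ 4 η)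
    (hp : Function.Periodic η lam)
    (hq : ∀ x, q x + 2 * g * η x + 2 * α * bending η x = C) :
    ∫ x in (0 : ℝ)..lam, q x = C * lam - 2 * g * ∫ x in (0 : ℝ)..lam, η x := by
  have e : ∀ x, q x = C - 2 * g * η x - 2 * α * bending η x := fun x => by linarith [hq x]
  have i1 : IntervalIntegrable (fun x => 2 * g * η x) MeasureTheory.volume 0 lam :=
    (h.continuous.const_mul _).intervalIntegrable _ _
  have i2 : IntervalIntegrable (fun x => 2 * α * bending η x) MeasureTheory.volume 0 lam :=
    ((continuous_bending h).const_mul _).intervalIntegrable _ _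
  simp_rw [e]
  rw [intervalIntegral.integral_sub (intervalIntegrable_const.sub i1) i2,
    intervalIntegral.integral_sub intervalIntegrable_const i1,
    intervalIntegral.integral_const_mul, intervalIntegral.integral_const_mul,
    integral_bending h hp]
  simp
  ring

end Bending

/-! ### Exactness of closed forms up to the boundary -/

/-- A closed `1`-form `a dx + b dy` on a convex set is exact up to the boundary. -/
theorem exists_hasGrad_of_convex {T : Set (ℝ × ℝ)} (hT : Convex ℝ T)
    {a b a₁ a₂ b₁ b₂ : ℝ × ℝ → ℝ} (ha : HasGrad T a a₁ a₂) (hb : HasGrad T b b₁ b₂)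
    (hab : EqOn a₂ b₁ T) : ∃ f, HasGrad T f a b := by
  refine hT.exists_forall_hasFDerivWithinAt_of_hasFDerivWithinAt_symmetric
    (fun z hz => ((ha z hz).smul_const (ContinuousLinearMap.fst ℝ ℝ ℝ)).add
      ((hb z hz).smul_const (ContinuousLinearMap.snd ℝ ℝ ℝ))) fun z hz v _ w _ => ?_
  simp [hab hz]
  ring

namespace Profile

variable {lam d : ℝ} {η : ℝ → ℝ} {β : ℝ≥0}

/-- A closed `1`-form `a dx + b dy` on the closed fluid domain is exact up to the boundary. -/
theorem exists_hasGrad (D : Profile lam d η) (hη : ContDiff ℝ 2 η) {a b a₁ a₂ b₁ b₂ : ℝ × ℝ → ℝ}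
    (ha : HasGrad (fluidBar d η) a a₁ a₂) (hb : HasGrad (fluidBar d η) b b₁ b₂)
    (hab : EqOn a₂ b₁ (fluidBar d η)) : ∃ f, HasGrad (fluidBar d η) f a b := by
  -- Convexity is gained by pulling back to a straight strip with `y = -d + t(η + d)`: the form
  -- becomes `(a + b tη') dx + b(η + d) dt`. Differentiating its first coefficient requires `η''`.
  set T : Set (ℝ × ℝ) := univ ×ˢ Icc (0 : ℝ) 1
  have hη' : ∀ x, HasDerivAt (deriv η) (deriv (deriv η) x) x := fun x => by
    have : ContDiff ℝ (1 + 1) η := by rwa [one_add_one_eq_two]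
    exact ((contDiff_succ_iff_deriv.1 this).2.2.differentiable (by simp) x).hasDerivAt
  have hφ := D.hasGrad_relative_height (S := T)
  have hm : ∀ z ∈ T, (z.1, -d + z.2 * (η z.1 + d)) ∈ fluidBar d η := fun z hz =>
    D.relative_height_mem hz.2 z.1
  have hdepth : ∀ S, HasGrad S (fun z => η z.1 + d) (fun z => deriv η z.1 * 1 + 0)
      (fun z => deriv η z.1 * 0 + 0) := fun S =>
    ((hasGrad_fst (S := S)).comp_deriv (mapsTo_univ _ _)
      (fun x _ => (D.hasDerivAt x).hasDerivWithinAt)).add (hasGrad_const d)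
  have hslope : HasGrad T (fun z => deriv η z.1) (fun z => deriv (deriv η) z.1 * 1)
      (fun z => deriv (deriv η) z.1 * 0) :=
    (hasGrad_fst (S := T)).comp_deriv (mapsTo_univ _ _) (fun x _ => (hη' x).hasDerivWithinAt)
  have hV := (ha.comp_graph hφ hm).add ((hb.comp_graph hφ hm).mul (hasGrad_snd.mul hslope))
  have hU := (hb.comp_graph hφ hm).mul (hdepth T)
  obtain ⟨F, hF⟩ := exists_hasGrad_of_convex (convex_univ.prod (convex_Icc (0 : ℝ) 1)) hV hU
    fun z hz => by
      simp only [hab (hm z hz)]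
      ring
  have hne : ∀ z ∈ fluidBar d η, η z.1 + d ≠ 0 := fun z _ => (D.depth_pos z.1).ne'
  -- The relative height `(y + d)/(η + d)` carries the potential back to the fluid domain.
  have hκ := (hasGrad_snd.add (hasGrad_const d)).mul ((hdepth (fluidBar d η)).inv hne)
  have hκφ : ∀ z ∈ fluidBar d η, -d + (z.2 + d) * (η z.1 + d)⁻¹ * (η z.1 + d) = z.2 := fun z hz => by
    have := hne z hz
    field_simp
    ring
  have hκm : ∀ z ∈ fluidBar d η, (z.1, (z.2 + d) * (η z.1 + d)⁻¹) ∈ T := fun z hz => by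
    obtain ⟨t, ht, e⟩ := D.exists_relative_height hz
    refine ⟨mem_univ _, ?_⟩
    have := hne z hz
    have e' : (z.2 + d) * (η z.1 + d)⁻¹ = t := by
      rw [← e]
      field_simp
      ring
    simpa only [e'] using ht
  refine ⟨_, (hF.comp_graph hκ hκm).congr (fun _ _ => rfl) (fun z hz => ?_) (fun z hz => ?_)⟩ <;>
  · simp only [hκφ z hz]
    have := hne z hz
    field_simp
    try ring

/-- A function on a closed strip whose first partial derivative vanishes depends on the second
variable only, and so does its second partial derivative. -/
theorem eq_of_grad_fst_zero {p : ℝ} (hp : p < 0) {F b : ℝ × ℝ → ℝ}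
    (h : HasGrad (fluidBar (-p) fun _ => 0) F (fun _ => 0) b) {x y : ℝ} (hy : y ∈ Icc p 0) :
    F (x, y) = F (0, y) ∧ b (x, y) = b (0, y) := by
  have hmem : ∀ x, ∀ y ∈ Icc p 0, (x, y) ∈ fluidBar (-p) fun _ => 0 := fun x y hy =>
    ⟨(neg_neg p).le.trans hy.1, hy.2⟩
  have h1 : ∀ y ∈ Icc p 0, F (x, y) = F (0, y) := fun y hy => by
    have hd : ∀ t, HasDerivAt (fun t => F (t, y)) 0 t := fun t => by
      rw [← hasDerivWithinAt_univ]
      simpa using h.hasDerivWithinAt_comp (hasDerivWithinAt_id t univ)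
        (hasDerivWithinAt_const t univ y) (mem_univ t) (fun t _ => hmem t y hy)
    exact is_const_of_deriv_eq_zero (fun t => (hd t).differentiableAt) (fun t => (hd t).deriv) _ _
  have hy' : y ∈ Icc (- -p) 0 := by rwa [neg_neg]
  have d1 := hasDerivWithinAt_vertical h (x := x) hy'
  have d2 := hasDerivWithinAt_vertical h (x := 0) hy'
  rw [neg_neg] at d1 d2
  -- `F (x, ·)` and `F (0, ·)` agree on the interval, so their derivatives within it agree,
  -- endpoints included.
  exact ⟨h1 y hy, (uniqueDiffOn_Icc hp y hy).eq_deriv _ (d1.congr (fun t ht => (h1 t ht).symm)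
    (h1 y hy).symm) d2 ▸ rfl⟩

end Profile

/-! ### Velocity and stream function -/

section

variable {α g d lam p₀ : ℝ} {β : ℝ≥0} {u v P ψ : ℝ × ℝ → ℝ} {η γ : ℝ → ℝ}

theorem VelocitySolution.profile (h : VelocitySolution α g d lam β u v P η) (hlam : 0 < lam) :
    Profile lam d η :=
  ⟨hlam, h.surface_above_bed, h.regular_η.of_le (by norm_num), h.periodic_η⟩

theorem StreamSolution.profile (h : StreamSolution α g d lam β p₀ γ ψ η) (hlam : 0 < lam) :
    Profile lam d η :=
  ⟨hlam, h.surface_above_bed, h.regular_η.of_le (by norm_num), h.periodic_η⟩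

theorem HolderClass.hasGrad_one {S : Set (ℝ × ℝ)} {f : ℝ × ℝ → ℝ} (h : HolderClass 1 β S f)
    (hS : UniqueDiffOn ℝ S) : HasGrad S f (d₁ S f) (d₂ S f) := (h.exists_hasGrad_one hS).1

theorem StreamSolution.exists_verticalInverse (h : StreamSolution α g d lam β p₀ γ ψ η)
    (hlam : 0 < lam) (hβ₀ : 0 < β) (hβ : β < 1) :
    ∃ k, IsVerticalInverse (fluidBar d η) (fluidBar (-p₀) fun _ => 0) (fun z => -ψ z) k ∧
      PeriodicOn lam (fluidBar (-p₀) fun _ => 0) k ∧ Hol β (fluidBar (-p₀) fun _ => 0) 2 k ∧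
      HasGrad (fluidBar (-p₀) fun _ => 0) k
        (fun z => -(-d₁ (fluidBar d η) ψ (z.1, k z) * (-d₂ (fluidBar d η) ψ (z.1, k z))⁻¹))
        (fun z => (-d₂ (fluidBar d η) ψ (z.1, k z))⁻¹) := by
  have D := h.profile hlam
  exact D.exists_verticalInverse (Profile.const hlam h.p₀_neg) hβ₀ hβ
    (h.regular_ψ.exists_hasGrad_two D.uniqueDiffOn).1.neg
    (D.hol_two hβ₀ hβ h.regular_ψ h.periodic_ψ).neg (fun z hz => by simp [h.periodic_ψ z hz])
    (fun z hz => neg_pos.2 (h.no_stagnation z hz)) (fun x => by simp [h.bed])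
    (fun x => by simp [h.surface])

theorem StreamSolution.of_mem_Ioo (h : StreamSolution α g d lam β p₀ γ ψ η) (hlam : 0 < lam)
    (hβ₀ : 0 < β) (hβ : β < 1) {p : ℝ} (hp : p ∈ Ioo p₀ 0) : ∃ z ∈ fluid d η, -ψ z = p := by
  obtain ⟨k, hk, -⟩ := h.exists_verticalInverse hlam hβ₀ hβ
  have hz : ((0 : ℝ), p) ∈ fluid (-p₀) fun _ => 0 := ⟨(neg_neg p₀).le.trans_lt hp.1, hp.2⟩
  exact ⟨_, hk.mem_fluid (fun x => by simp [h.bed]) (fun x => by simp [h.surface]) hz,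
    hk.right _ (Profile.fluid_subset hz)⟩

/-- A stream-function solution is determined by its velocity field. -/
theorem StreamSolution.unique {p₀' : ℝ} {γ' : ℝ → ℝ} {ψ' : ℝ × ℝ → ℝ} (hlam : 0 < lam)
    (hβ₀ : 0 < β) (hβ : β < 1) (h : StreamSolution α g d lam β p₀ γ ψ η)
    (h' : StreamSolution α g d lam β p₀' γ' ψ' η) (hu : IsStreamFunctionOf d η ψ u v)
    (hu' : IsStreamFunctionOf d η ψ' u v) :
    p₀' = p₀ ∧ EqOn γ' γ (Icc p₀ 0) ∧ EqOn ψ' ψ (fluidBar d η) := by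
  have D := h.profile hlam
  have hS := D.uniqueDiffOn
  have e : EqOn ψ' ψ (fluidBar d η) :=
    Profile.eqOn_of_vertical (h'.regular_ψ.exists_hasGrad_two hS).1
      (h.regular_ψ.exists_hasGrad_two hS).1 (fun z hz => (hu' z hz).2.trans (hu z hz).2.symm)
      fun x => (h'.surface x).trans (h.surface x).symm
  have ep : p₀' = p₀ := by
    have := e (D.bed_mem 0)
    rw [h.bed, h'.bed] at this
    linarith
  subst ep
  refine ⟨rfl, ?_, e⟩
  obtain ⟨C, hC⟩ := h.regular_γ
  obtain ⟨C', hC'⟩ := h'.regular_γ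
  -- The Poisson equation determines `γ` at the values of `-ψ` in the open domain, which fill `(p₀,
  -- 0)`; continuity adds the endpoints.
  refine Set.EqOn.of_subset_closure (s := Ioo p₀' 0) (fun p hp => ?_) (hC'.continuousOn hβ₀)
    (hC.continuousOn hβ₀) Ioo_subset_Icc_self (closure_Ioo h.p₀_neg.ne).ge
  obtain ⟨z, hz, rfl⟩ := h.of_mem_Ioo hlam hβ₀ hβ hp
  have hz' := Profile.fluid_subset hz
  rw [← h.poisson z hz, ← e hz', ← h'.poisson z hz, d₁_congr (d₁_congr e) hz',
    d₂_congr (d₂_congr e) hz']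

theorem VelocitySolution.exists_stream (hlam : 0 < lam) (hβ₀ : 0 < β) (hβ : β < 1)
    (h : VelocitySolution α g d lam β u v P η) :
    ∃ (p₀ : ℝ) (γ : ℝ → ℝ) (ψ : ℝ × ℝ → ℝ),
      StreamSolution α g d lam β p₀ γ ψ η ∧ IsStreamFunctionOf d η ψ u v := by
  have D := h.profile hlam
  have hS := D.uniqueDiffOn
  have hu := h.regular_u.hasGrad_one hS
  have hv := h.regular_v.hasGrad_one hS
  have hP := h.regular_P.hasGrad_one hS
  have Hu := D.hol_one hβ₀ hβ h.regular_u h.periodic_u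
  have Hv := D.hol_one hβ₀ hβ h.regular_v h.periodic_v
  have HP := D.hol_one hβ₀ hβ h.regular_P h.periodic_P
  obtain ⟨Hu1, Hu2⟩ := Hu.grad hS hu
  obtain ⟨Hv1, Hv2⟩ := Hv.grad hS hv
  obtain ⟨HP1, HP2⟩ := HP.grad hS hP
  have inc : EqOn (fun z => d₁ (fluidBar d η) u z + d₂ (fluidBar d η) v z) (fun _ => 0) (fluidBar d η) :=
    D.eqOn_fluidBar ((Hu1.add Hv2).bddHolder.continuousOn hβ₀) continuousOn_const h.incompressible
  have mx : EqOn (fun z => u z * d₁ (fluidBar d η) u z + v z * d₂ (fluidBar d η) u z) (fun z => -d₁ (fluidBar d η) P z) (fluidBar d η) :=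
    D.eqOn_fluidBar (((Hu.of_succ.mul Hu1).add (Hv.of_succ.mul Hu2)).bddHolder.continuousOn hβ₀)
      (HP1.neg.bddHolder.continuousOn hβ₀) h.momentum_x
  have my : EqOn (fun z => u z * d₁ (fluidBar d η) v z + v z * d₂ (fluidBar d η) v z) (fun z => -d₂ (fluidBar d η) P z - g) (fluidBar d η) :=
    D.eqOn_fluidBar (((Hu.of_succ.mul Hv1).add (Hv.of_succ.mul Hv2)).bddHolder.continuousOn hβ₀)
      ((HP2.neg.sub (hol_const g)).bddHolder.continuousOn hβ₀) h.momentum_y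
  obtain ⟨ψ₀, hψ₀⟩ := D.exists_hasGrad (h.regular_η.of_le (by norm_num)) hv.neg hu
    fun z hz => by linarith [inc hz]
  -- The kinematic condition says that `ψ₀` is constant along the surface; that constant is
  -- subtracted.
  obtain ⟨ψ, hψ, hsurf⟩ : ∃ ψ, HasGrad (fluidBar d η) ψ (fun z => -v z) u ∧ ∀ x, ψ (x, η x) = 0 := by
    have hd := D.hasDerivAt_surface hψ₀
    have hd' : ∀ x, deriv (fun x => ψ₀ (x, η x)) x = 0 := fun x => by
      rw [(hd x).deriv, h.kinematic_surface]
      ring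
    refine ⟨fun z => ψ₀ z - ψ₀ (0, η 0), (hψ₀.sub (hasGrad_const _)).congr (fun _ _ => rfl)
      (fun _ _ => by simp) (fun _ _ => by simp), fun x => sub_eq_zero.2 ?_⟩
    exact is_const_of_deriv_eq_zero (fun x => (hd x).differentiableAt) hd' x 0
  have hbed : ∀ x, ψ (x, -d) = ψ (0, -d) := fun x => by
    have hd := D.hasDerivAt_bed hψ
    exact is_const_of_deriv_eq_zero (fun x => (hd x).differentiableAt)
      (fun x => by rw [(hd x).deriv, h.kinematic_bed, neg_zero]) x 0
  -- `ψ` and its translate share the vertical derivative `u` and vanish on the surface.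
  have hper : PeriodicOn lam (fluidBar d η) ψ := fun z hz =>
    Profile.eqOn_of_vertical (D.hasGrad_translate hψ) hψ h.periodic_u
      (fun x => by
        have := hsurf (x + lam)
        rw [D.periodic x] at this
        rw [hsurf]
        exact this) hz
  have Hψ : Hol β (fluidBar d η) 2 ψ := D.hol_succ hβ₀ hβ hψ hper Hv.neg Hu
  have hf : HasGrad (fluidBar d η) (fun z => -ψ z) v (fun z => -u z) :=
    hψ.neg.congr (fun _ _ => rfl) (fun _ _ => by simp) (fun _ _ => rfl)
  have hupos : ∀ z ∈ (fluidBar d η), 0 < -u z := fun z hz => neg_pos.2 (h.no_stagnation z hz)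
  have hune : ∀ z ∈ (fluidBar d η), u z ≠ 0 := fun z hz => (h.no_stagnation z hz).ne
  set p₀ := -ψ (0, -d) with hp₀
  have hp₀neg : p₀ < 0 := by
    obtain ⟨c, hc0, hc⟩ := D.exists_pos_lower_bound (Hu.neg.bddHolder.continuousOn hβ₀)
      (fun z hz => by simp [h.periodic_u z hz]) hupos
    have := Profile.mul_sub_le_vertical hf hc (D.bed_mem 0) (D.surface_mem 0) (D.above 0).le
    rw [hsurf] at this
    have := mul_pos hc0 (sub_pos.2 (D.above 0))
    linarith
  have D' := Profile.const hlam hp₀neg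
  obtain ⟨k, hk, -, Hk, hkg⟩ := D.exists_verticalInverse D' hβ₀ hβ hf Hψ.neg
    (fun z hz => by simp [hper z hz]) hupos (fun x => by simp [hbed x, hp₀])
    (fun x => by simp [hsurf])
  -- The total head is constant along streamlines, and its gradient is the vorticity times `∇ψ`.
  set ζ : ℝ × ℝ → ℝ := fun z => d₂ (fluidBar d η) u z - d₁ (fluidBar d η) v z
  have hE := ((hP.add (((hu.mul hu).add (hv.mul hv)).mul (hasGrad_const (1 / 2)))).add
    ((hasGrad_snd (S := fluidBar d η)).mul (hasGrad_const g)))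
  -- Here `k_x = v/u` and `k_p = -1/u`, so the derivatives of the head are `-vζ + uζ · v/u = 0` and
  -- `-ζ`.
  have hÊ : HasGrad (fluidBar (-p₀) fun _ => 0)
      (fun z => P (z.1, k z) + (u (z.1, k z) * u (z.1, k z) + v (z.1, k z) * v (z.1, k z)) * (1 / 2)
        + k z * g) (fun _ => 0) (fun z => -ζ (z.1, k z)) := by
    refine (hE.comp_graph hkg hk.mem_symm).congr (fun _ _ => rfl) (fun z hz => ?_) (fun z hz => ?_)
    all_goals
      have hm := hk.mem_symm z hz
      have h1 := mx hm
      have h2 := my hm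
      have h3 := hune _ hm
      simp only at h1 h2
      have e1 : d₁ (fluidBar d η) P (z.1, k z) = -(u (z.1, k z) * d₁ (fluidBar d η) u (z.1, k z)
        + v (z.1, k z) * d₂ (fluidBar d η) u (z.1, k z)) := by linarith
      have e2 : d₂ (fluidBar d η) P (z.1, k z) = -(u (z.1, k z) * d₁ (fluidBar d η) v (z.1, k z)
        + v (z.1, k z) * d₂ (fluidBar d η) v (z.1, k z)) - g := by linarith
      simp only [e1, e2, ζ]
      field_simp
      try ring
  have hÊc := fun x y hy => Profile.eq_of_grad_fst_zero hp₀neg hÊ (x := x) (y := y) hy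
  have hstrip : ∀ z ∈ (fluidBar d η), -ψ z ∈ Icc p₀ 0 := fun z hz => by
    have := hk.mem z hz
    exact ⟨(neg_neg p₀).ge.trans this.1, this.2⟩
  have hmem0 : ∀ p ∈ Icc p₀ 0, ((0 : ℝ), p) ∈ fluidBar (-p₀) fun _ => 0 := fun p hp =>
    ⟨(neg_neg p₀).le.trans hp.1, hp.2⟩
  have hd1 := hψ.d₁_eq hS
  have hd2 := hψ.d₂_eq hS
  -- The vorticity is constant on streamlines, so its values on the vertical `x = 0` define `γ`.
  refine ⟨p₀, fun p => ζ (0, k (0, p)), ψ, ⟨hp₀neg, h.surface_above_bed, h.regular_η,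
    Hψ.holderClass_two hβ₀ hS, ?_, h.periodic_η, hper, ?_, hsurf, fun x => by rw [hbed, hp₀, neg_neg],
    ?_, fun z hz => ?_⟩, fun z hz => ⟨hd1 hz, hd2 hz⟩⟩
  · have Hζ : Hol β (fluidBar d η) 0 ζ := Hu2.sub Hv1
    obtain ⟨L, hL⟩ := D'.exists_lipschitz_of_hol Hk.of_succ
    have H1 := (Hζ.comp_graph Hk.of_succ.of_succ hk.mem_symm hL).bddHolder
    exact (H1.comp_lipschitz (L := 1) (K := fun p : ℝ => ((0 : ℝ), p)) hmem0
      fun z _ w _ => by simp [Prod.dist_eq]).exists_holderOnWith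
  · intro z hz
    have hz' := Profile.fluid_subset hz
    have e1 := (hÊc z.1 _ (hstrip z hz')).2
    have e2 := hk.left z hz'
    simp only [e2] at e1
    rw [d₁_congr hd1 hz', d₂_congr hd2 hz', hv.neg.d₁_eq hS hz']
    simp only [ζ] at e1 ⊢
    linarith
  · have hk0 : ∀ x, k (x, 0) = η x := fun x => by
      have := hk.left _ (D.surface_mem x)
      simpa [hsurf] using this
    -- `C` is the head at one, hence every, surface point. Mean zero of `η` identifies `2C` with the
    -- average required.
    set C := P (0, η 0) + (u (0, η 0) * u (0, η 0) + v (0, η 0) * v (0, η 0)) * (1 / 2) + η 0 * g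
    have hC : ∀ x, (d₁ (fluidBar d η) ψ (x, η x) ^ 2 + d₂ (fluidBar d η) ψ (x, η x) ^ 2) + 2 * g * η x
        + 2 * α * bending η x = 2 * C := fun x => by
      have := (hÊc x 0 ⟨hp₀neg.le, le_rfl⟩).1
      simp only [hk0] at this
      rw [hd1 (D.surface_mem x), hd2 (D.surface_mem x)]
      rw [h.dynamic x] at this
      simp only [C]
      linear_combination 2 * this
    intro x
    rw [integral_of_bernoulli h.regular_η h.periodic_η hC, h.mean_zero, hC x]
    field_simp
    ring
  · rw [hd2 hz]
    exact h.no_stagnation z hz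

theorem StreamSolution.exists_velocity (hg : 0 < g) (hlam : 0 < lam) (hβ₀ : 0 < β) (hβ : β < 1)
    (h : StreamSolution α g d lam β p₀ γ ψ η) :
    ∃ u v P : ℝ × ℝ → ℝ,
      VelocitySolution α g d lam β u v P η ∧ IsStreamFunctionOf d η ψ u v := by
  have D := h.profile hlam
  have hS := D.uniqueDiffOn
  obtain ⟨hψ, ⟨ha, -⟩, ⟨hb, -⟩⟩ := h.regular_ψ.exists_hasGrad_two hS
  have Hψ := D.hol_two hβ₀ hβ h.regular_ψ h.periodic_ψ
  obtain ⟨Ha, Hb⟩ := Hψ.grad hS hψ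
  obtain ⟨pa, pb⟩ := D.periodicOn_grad hψ h.periodic_ψ
  obtain ⟨k, hk, -⟩ := h.exists_verticalInverse hlam hβ₀ hβ
  have hstrip : MapsTo (fun z => -ψ z) (fluidBar d η) (Icc p₀ 0) := fun z hz => by
    have := hk.mem z hz
    exact ⟨(neg_neg p₀).ge.trans this.1, this.2⟩
  have hmix := D.mixed_eq (by exact_mod_cast h.regular_ψ.1) hψ ha hb
  set a := d₁ (fluidBar d η) ψ
  set b := d₂ (fluidBar d η) ψ
  obtain ⟨C, hC⟩ := h.regular_γ
  -- Extending `γ` by its endpoint values makes its primitive `Γ` differentiable on the whole line.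
  have hγc : Continuous (fun p => γ (projIcc p₀ 0 h.p₀_neg.le p)) :=
    (hC.continuousOn hβ₀).domRestrict.comp continuous_projIcc
  set Γ : ℝ → ℝ := fun p => ∫ s in (0 : ℝ)..p, γ (projIcc p₀ 0 h.p₀_neg.le s)
  have hΓ : ∀ p ∈ Icc p₀ 0, HasDerivWithinAt Γ (γ p) (Icc p₀ 0) p := fun p hp => by
    have := (hγc.integral_hasStrictDerivAt 0 p).hasDerivAt.hasDerivWithinAt (s := Icc p₀ 0)
    rwa [projIcc_of_mem _ hp] at this
  have hΓψ := hψ.neg.comp_deriv hstrip hΓ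
  set c := 1 / lam * ∫ s in (0 : ℝ)..lam, (a (s, η s) ^ 2 + b (s, η s) ^ 2)
  have hP := ((((ha.mul ha).add (hb.mul hb)).mul (hasGrad_const (-(1 / 2)))).sub
    ((hasGrad_snd (S := fluidBar d η)).mul (hasGrad_const g))).sub (hΓψ.sub (hasGrad_const (c / 2)))
  -- Bernoulli's law solved for the pressure; since `Γ 0 = 0`, the constant `c / 2` yields exactly
  -- the dynamic condition on the surface.
  set P : ℝ × ℝ → ℝ := fun z => (a z * a z + b z * b z) * -(1 / 2) - z.2 * g - (Γ (-ψ z) - c / 2)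
  have pψ : PeriodicOn lam (fluidBar d η) (fun z => Γ (-ψ z) - c / 2) := fun z hz => by
    simp only [h.periodic_ψ z hz]
  have pP : PeriodicOn lam (fluidBar d η) P := fun z hz => by
    simp only [P, h.periodic_ψ z hz, pa z hz, pb z hz]
  have HΓψ : Hol β (fluidBar d η) 1 (fun z => Γ (-ψ z) - c / 2) := by
    have Hγ : BddHolder β (fluidBar d η) (fun z => γ (-ψ z)) := by
      obtain ⟨L, hL⟩ := D.exists_lipschitz_of_hol Hψ.of_succ
      obtain ⟨M, hM⟩ := isCompact_Icc.exists_bound_of_continuousOn (hC.continuousOn hβ₀)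
      refine (BddHolder.of_holderOnWith hC hM).comp_lipschitz (L := L) hstrip fun z hz w hw => ?_
      rw [dist_neg_neg]
      exact hL z hz w hw
    have H1 : Hol β (fluidBar d η) 0 (fun z => γ (-ψ z)) := Hγ
    exact D.hol_succ hβ₀ hβ (hΓψ.sub (hasGrad_const (c / 2))) pψ
      ((H1.mul Ha.of_succ.neg).sub (hol_const 0)) ((H1.mul Hb.of_succ.neg).sub (hol_const 0))
  have Hy : Hol β (fluidBar d η) 1 (fun z => z.2) :=
    D.hol_succ hβ₀ hβ hasGrad_snd (fun _ _ => rfl) (hol_const 0) (hol_const 1)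
  have HP : Hol β (fluidBar d η) 1 P := ((((Ha.mul Ha).add (Hb.mul Hb)).mul (hol_const _)).sub
    (Hy.mul (hol_const g))).sub HΓψ
  have hbern : ∀ x, a (x, η x) ^ 2 + b (x, η x) ^ 2 + 2 * g * η x + 2 * α * bending η x = c :=
    h.bernoulli
  refine ⟨b, fun z => -a z, P, ⟨h.surface_above_bed, h.regular_η, Hb.holderClass_one hβ₀ hS,
    Ha.neg.holderClass_one hβ₀ hS, HP.holderClass_one hβ₀ hS, h.periodic_η, pb,
    fun z hz => by simp [pa z hz], pP, ?_, ?_, ?_, ?_, ?_, ?_, ?_, h.no_stagnation⟩,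
    fun z hz => ⟨by simp [a], rfl⟩⟩
  · intro z hz
    have hz' := Profile.fluid_subset hz
    have e := h.poisson z hz
    have e2 := hmix hz'
    change d₁ (fluidBar d η) a z + d₂ (fluidBar d η) b z = _ at e
    change d₂ (fluidBar d η) a z = d₁ (fluidBar d η) b z at e2
    rw [hP.d₁_eq hS hz']
    simp only [← e, ← e2]
    ring
  · intro z hz
    have hz' := Profile.fluid_subset hz
    have e := h.poisson z hz
    have e2 := hmix hz'
    change d₁ (fluidBar d η) a z + d₂ (fluidBar d η) b z = _ at e
    rw [hP.d₂_eq hS hz', ha.neg.d₁_eq hS hz', ha.neg.d₂_eq hS hz']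
    simp only [← e]
    ring
  · intro z hz
    have hz' := Profile.fluid_subset hz
    have e2 := hmix hz'
    change d₂ (fluidBar d η) a z = d₁ (fluidBar d η) b z at e2
    rw [ha.neg.d₂_eq hS hz']
    linarith
  · intro x
    have hΓ0 : Γ 0 = 0 := intervalIntegral.integral_same
    have := hbern x
    simp only [P, h.surface, neg_zero, hΓ0]
    linear_combination (-1 / 2) * this
  · intro x
    have hd := D.hasDerivAt_surface hψ x
    have h0 : (fun x => ψ (x, η x)) = fun _ => 0 := funext h.surface
    rw [h0] at hd
    have := hd.unique (hasDerivAt_const x 0)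
    linarith
  · intro x
    have hd := D.hasDerivAt_bed hψ x
    have h0 : (fun x => ψ (x, -d)) = fun _ => -p₀ := funext h.bed
    rw [h0] at hd
    have := hd.unique (hasDerivAt_const x (-p₀))
    linarith
  · have h1 := integral_of_bernoulli h.regular_η h.periodic_η hbern
    -- The constant `c` is the average of `|∇ψ|²`, so the integrated Bernoulli condition leaves `g ∫
    -- η = 0`.
    have h2 : c * lam = ∫ s in (0 : ℝ)..lam, (a (s, η s) ^ 2 + b (s, η s) ^ 2) := by
      simp only [c]
      field_simp
    rw [← h2] at h1
    have h3 : g * ∫ x in (0 : ℝ)..lam, η x = 0 := by linarith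
    exact (mul_eq_zero.1 h3).resolve_left hg.ne'

/-- `∇ψ` fixes the velocity; the second momentum equation fixes `P_y`, and the dynamic condition
fixes `P` on the surface. -/
theorem VelocitySolution.unique {u' v' P' : ℝ × ℝ → ℝ} (hlam : 0 < lam) (hβ₀ : 0 < β) (hβ : β < 1)
    (h : VelocitySolution α g d lam β u v P η) (h' : VelocitySolution α g d lam β u' v' P' η)
    (hu : IsStreamFunctionOf d η ψ u v) (hu' : IsStreamFunctionOf d η ψ u' v') :
    EqOn u' u (fluidBar d η) ∧ EqOn v' v (fluidBar d η) ∧ EqOn P' P (fluidBar d η) := by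
  have D := h.profile hlam
  have hS := D.uniqueDiffOn
  have eu : EqOn u' u (fluidBar d η) := fun z hz => (hu' z hz).2.symm.trans (hu z hz).2
  have ev : EqOn v' v (fluidBar d η) := fun z hz =>
    neg_injective ((hu' z hz).1.symm.trans (hu z hz).1)
  have hP := h.regular_P.hasGrad_one hS
  have hP' := h'.regular_P.hasGrad_one hS
  have HP := ((D.hol_one hβ₀ hβ h.regular_P h.periodic_P).grad hS hP).2
  have HP' := ((D.hol_one hβ₀ hβ h'.regular_P h'.periodic_P).grad hS hP').2
  refine ⟨eu, ev, Profile.eqOn_of_vertical hP' hP (D.eqOn_fluidBar (HP'.bddHolder.continuousOn hβ₀)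
    (HP.bddHolder.continuousOn hβ₀) fun z hz => ?_) fun x => (h'.dynamic x).trans (h.dynamic x).symm⟩
  have hz' := Profile.fluid_subset hz
  have h1 := h.momentum_y z hz
  have h2 := h'.momentum_y z hz
  rw [eu hz', ev hz', d₁_congr ev hz', d₂_congr ev hz'] at h2
  linarith

end

/-! ### Stream function and height function -/

section

variable {α g d lam p₀ : ℝ} {β : ℝ≥0} {ψ h : ℝ × ℝ → ℝ} {η γ : ℝ → ℝ}

/-- Viewing the strip as a fluid domain of depth `-p₀` makes every result on profiles available for
it. -/
theorem stripBar_eq (p₀ : ℝ) : stripBar p₀ = fluidBar (-p₀) fun _ => 0 := by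
  simp [stripBar, fluidBar]

theorem strip_eq (p₀ : ℝ) : strip p₀ = fluid (-p₀) fun _ => 0 := by
  simp [strip, fluid]

theorem StreamSolution.exists_height (hlam : 0 < lam) (hβ₀ : 0 < β) (hβ : β < 1)
    (hs : StreamSolution α g d lam β p₀ γ ψ η) :
    ∃ h, HeightSolution α g d lam β p₀ γ h ∧ IsHeightFunctionOf d η ψ h := by
  obtain ⟨k, hk, hkp, Hk, hkg⟩ := hs.exists_verticalInverse hlam hβ₀ hβ
  have D := hs.profile hlam
  have D' := Profile.const hlam hs.p₀_neg
  have hS := D.uniqueDiffOn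
  have hT := D'.uniqueDiffOn
  obtain ⟨hψ, ⟨ha, -⟩, ⟨hb, -⟩⟩ := hs.regular_ψ.exists_hasGrad_two hS
  have hmix := D.mixed_eq (by exact_mod_cast hs.regular_ψ.1) hψ ha hb
  have hne : ∀ z ∈ fluidBar d η, d₂ (fluidBar d η) ψ z ≠ 0 := fun z hz => (hs.no_stagnation z hz).ne
  have hk0 : ∀ x, k (x, 0) = η x := fun x => by
    simpa [hs.surface] using hk.left _ (D.surface_mem x)
  have hkb : ∀ x, k (x, p₀) = -d := fun x => by
    simpa [hs.bed] using hk.left _ (D.bed_mem x)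
  have h1 := hkg.d₁_eq hT
  have h2 := hkg.d₂_eq hT
  obtain ⟨⟨kxx, kxy, gx, exx, exy⟩, kyx, kyy, gy, eyy⟩ :=
    hk.hasGrad_grad hkg ha.neg hb.neg fun z hz => neg_ne_zero.2 (hne z hz)
  -- From `h_q = -ψ_x/ψ_y` and `h_p = -1/ψ_y`.
  have hq : ∀ x, (1 + d₁ (fluidBar (-p₀) fun _ => 0) k (x, 0) ^ 2)
      / d₂ (fluidBar (-p₀) fun _ => 0) k (x, 0) ^ 2
      = d₁ (fluidBar d η) ψ (x, η x) ^ 2 + d₂ (fluidBar d η) ψ (x, η x) ^ 2 := fun x => by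
    have := hne _ (D.surface_mem x)
    rw [h1 (D'.surface_mem x), h2 (D'.surface_mem x)]
    simp only [hk0]
    field_simp
    try ring
  have hη : (fun s => k (s, 0)) = η := funext hk0
  refine ⟨k, ⟨hs.p₀_neg, ?_, by rw [hη]; exact hs.regular_η, hs.regular_γ, ?_, ?_, hkb, ?_, ?_⟩,
    hk0, hk.left⟩
  · rw [stripBar_eq]
    exact Hk.holderClass_two hβ₀ hT
  · rwa [stripBar_eq]
  · rw [stripBar_eq, strip_eq]
    intro z hz
    have hz' := Profile.fluid_subset hz
    have hm := hk.mem_symm z hz'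
    have hf := hk.mem_fluid (fun x => by simp [hs.bed]) (fun x => by simp [hs.surface]) hz
    have e := hs.poisson _ hf
    have er := hk.right z hz'
    rw [er] at e
    -- By the formulas for the inverse, the second-order part of the height equation equals `h_p³
    -- Δψ` at the corresponding point; this uses `ψ_xy = ψ_yx`.
    rw [d₂_congr h2 hz', d₂_congr h1 hz', d₁_congr h1 hz', gx.d₁_eq hT hz', gx.d₂_eq hT hz',
      gy.d₂_eq hT hz', h1 hz', h2 hz', exx z hz', exy z hz', eyy z hz', ← e, hmix hm]
    have := hne _ hm
    field_simp
    ring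
  · rw [stripBar_eq]
    intro x
    simp only [hq, hk0]
    exact hs.bernoulli x
  · rw [stripBar_eq]
    intro z hz
    rw [h2 hz]
    exact inv_pos.2 (neg_pos.2 (hs.no_stagnation _ (hk.mem_symm z hz)))

/-- Every point of the closed strip has the form `(x, -ψ(x, y))`, where the value is prescribed. -/
theorem StreamSolution.height_unique {h' : ℝ × ℝ → ℝ} (hlam : 0 < lam) (hβ₀ : 0 < β) (hβ : β < 1)
    (hs : StreamSolution α g d lam β p₀ γ ψ η) (hh : IsHeightFunctionOf d η ψ h)
    (hh' : IsHeightFunctionOf d η ψ h') : EqOn h' h (stripBar p₀) := by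
  obtain ⟨k, hk, -⟩ := hs.exists_verticalInverse hlam hβ₀ hβ
  rw [stripBar_eq]
  intro z hz
  have h1 := hh.2 _ (hk.mem_symm z hz)
  have h2 := hh'.2 _ (hk.mem_symm z hz)
  have h3 := hk.right z hz
  simp only at h1 h2 h3
  rw [h3] at h1 h2
  exact h2.trans h1.symm

theorem HeightSolution.exists_verticalInverse (hh : HeightSolution α g d lam β p₀ γ h)
    (hlam : 0 < lam) (hβ₀ : 0 < β) (hβ : β < 1) :
    Profile lam d (fun x => h (x, 0)) ∧
    ∃ k, IsVerticalInverse (fluidBar (-p₀) fun _ => 0) (fluidBar d fun x => h (x, 0)) h k ∧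
      PeriodicOn lam (fluidBar d fun x => h (x, 0)) k ∧
      Hol β (fluidBar d fun x => h (x, 0)) 2 k ∧
      HasGrad (fluidBar d fun x => h (x, 0)) k
        (fun z => -(d₁ (stripBar p₀) h (z.1, k z) * (d₂ (stripBar p₀) h (z.1, k z))⁻¹))
        (fun z => (d₂ (stripBar p₀) h (z.1, k z))⁻¹) := by
  have D := Profile.const hlam hh.p₀_neg
  have hr := hh.regular_h
  have hp := hh.periodic_h
  have hst := hh.no_stagnation
  rw [stripBar_eq] at hr hp hst ⊢
  have hS := D.uniqueDiffOn
  have H := D.hol_two hβ₀ hβ hr hp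
  have hg := (hr.exists_hasGrad_two hS).1
  have hbed : ∀ x, h (x, - -p₀) = -d := fun x => by rw [neg_neg, hh.bed]
  have D' : Profile lam d (fun x => h (x, 0)) := by
    -- That the surface lies above the bed is derived: `h` starts at `-d` and grows in `p` at rate
    -- at least `c > 0`.
    refine ⟨hlam, fun x => ?_, hh.regular_trace.of_le (by norm_num),
      fun x => hp _ (D.surface_mem x)⟩
    obtain ⟨c, hc0, hc⟩ := D.exists_pos_lower_bound ((H.grad hS hg).2.bddHolder.continuousOn hβ₀)
      (D.periodicOn_grad hg hp).2 hst
    have := Profile.mul_sub_le_vertical hg hc (x := x) (D.bed_mem x) (D.surface_mem x) (D.above x).le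
    rw [hbed] at this
    have := mul_pos hc0 (sub_pos.2 (D.above x))
    linarith
  exact ⟨D', D.exists_verticalInverse D' hβ₀ hβ hg H hp hst hbed fun _ => rfl⟩

theorem HeightSolution.exists_stream (hlam : 0 < lam) (hβ₀ : 0 < β) (hβ : β < 1)
    (hh : HeightSolution α g d lam β p₀ γ h) :
    ∃ (ψ : ℝ × ℝ → ℝ) (η : ℝ → ℝ),
      StreamSolution α g d lam β p₀ γ ψ η ∧ IsHeightFunctionOf d η ψ h := by
  obtain ⟨D, k, hk, hkp, Hk, hkg⟩ := hh.exists_verticalInverse hlam hβ₀ hβ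
  have D' := Profile.const hlam hh.p₀_neg
  have hr := hh.regular_h
  have hst := hh.no_stagnation
  have hel := hh.elliptic
  have hbern := hh.bernoulli
  rw [strip_eq] at hel
  simp only [stripBar_eq] at hr hst hel hbern hkg
  have hS := D.uniqueDiffOn
  have hT := D'.uniqueDiffOn
  obtain ⟨hψ, ⟨ha, -⟩, ⟨hb, -⟩⟩ := hr.exists_hasGrad_two hT
  have hmix := D'.mixed_eq (by exact_mod_cast hr.1) hψ ha hb
  have hne := fun z hz => (hst z hz).ne'
  have hbed : ∀ x, h (x, - -p₀) = -d := fun x => by rw [neg_neg, hh.bed]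
  have hk0 : ∀ x, k (x, h (x, 0)) = 0 := fun x => hk.left _ (D'.surface_mem x)
  have hkb : ∀ x, k (x, -d) = p₀ := fun x => by
    simpa [hh.bed] using hk.left _ (D'.bed_mem x)
  have h1 := hkg.neg.d₁_eq hS
  have h2 := hkg.neg.d₂_eq hS
  obtain ⟨⟨kxx, kxy, gx, exx, exy⟩, kyx, kyy, gy, eyy⟩ := hk.hasGrad_grad hkg ha hb hne
  have hq : ∀ x, d₁ (fluidBar d fun x => h (x, 0)) (fun z => -k z) (x, h (x, 0)) ^ 2
      + d₂ (fluidBar d fun x => h (x, 0)) (fun z => -k z) (x, h (x, 0)) ^ 2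
      = (1 + d₁ (fluidBar (-p₀) fun _ => 0) h (x, 0) ^ 2)
        / d₂ (fluidBar (-p₀) fun _ => 0) h (x, 0) ^ 2 := fun x => by
    have := hne _ (D'.surface_mem x)
    rw [h1 (D.surface_mem x), h2 (D.surface_mem x)]
    simp only [hk0]
    field_simp
    ring
  refine ⟨fun z => -k z, fun x => h (x, 0), ⟨hh.p₀_neg, D.above, hh.regular_trace,
    Hk.neg.holderClass_two hβ₀ hS, hh.regular_γ, D.periodic, fun z hz => by simp [hkp z hz], ?_,
    fun x => by simp [hk0], fun x => by simp [hkb], ?_, ?_⟩, fun _ => rfl,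
    fun z hz => by simpa using hk.right z hz⟩
  · intro z hz
    have hz' := Profile.fluid_subset hz
    have hm := hk.mem_symm z hz'
    have e := hel _ (hk.mem_fluid hbed (fun _ => rfl) hz)
    rw [d₁_congr h1 hz', d₂_congr h2 hz', gx.neg.d₁_eq hS hz', gy.neg.d₂_eq hS hz']
    simp only [exx z hz', eyy z hz', neg_neg, hmix hm] at e ⊢
    have := hne _ hm
    rw [← sub_eq_zero]
    field_simp
    linear_combination e
  · intro x
    simp only [hq]
    exact hbern x
  · intro z hz
    rw [h2 hz]
    exact neg_neg_of_pos (inv_pos.2 (hst _ (hk.mem_symm z hz)))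

theorem HeightSolution.stream_unique {ψ' : ℝ × ℝ → ℝ} {η' : ℝ → ℝ} (hlam : 0 < lam) (hβ₀ : 0 < β)
    (hβ : β < 1) (hh : HeightSolution α g d lam β p₀ γ h)
    (hs : StreamSolution α g d lam β p₀ γ ψ η) (hs' : StreamSolution α g d lam β p₀ γ ψ' η')
    (he : IsHeightFunctionOf d η ψ h) (he' : IsHeightFunctionOf d η' ψ' h) :
    η' = η ∧ EqOn ψ' ψ (fluidBar d η) := by
  have e : η' = η := funext fun x => (he'.1 x).symm.trans (he.1 x)
  subst e
  obtain ⟨-, k, hk, -⟩ := hh.exists_verticalInverse hlam hβ₀ hβ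
  -- These inverses serve only to place `(x, -ψ)` and `(x, -ψ')` in the strip, where `h` is
  -- injective in `p`.
  obtain ⟨_, hk1, -⟩ := hs.exists_verticalInverse hlam hβ₀ hβ
  obtain ⟨_, hk2, -⟩ := hs'.exists_verticalInverse hlam hβ₀ hβ
  refine ⟨rfl, fun z hz => neg_injective ?_⟩
  have e1 := hk.left _ (hk1.mem z hz)
  have e2 := hk.left _ (hk2.mem z hz)
  simp only [he.2 z hz] at e1
  simp only [he'.2 z hz] at e2
  exact e2.symm.trans e1

end

end Hydroelastic

open Hydroelastic in
theorem proposition2p1 (α g d lam : ℝ) (hα : 0 < α) (hg : 0 < g) (hd : 0 < d) (hlam : 0 < lam)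
    (β : NNReal) (hβ₀ : 0 < β) (hβ₁ : β < 1) :
    -- velocity formulation to stream-function formulation
    (∀ (u v P : ℝ × ℝ → ℝ) (η : ℝ → ℝ), VelocitySolution α g d lam β u v P η →
      ∃ (p₀ : ℝ) (γ : ℝ → ℝ) (ψ : ℝ × ℝ → ℝ),
        (StreamSolution α g d lam β p₀ γ ψ η ∧ IsStreamFunctionOf d η ψ u v) ∧
        ∀ (p₀' : ℝ) (γ' : ℝ → ℝ) (ψ' : ℝ × ℝ → ℝ),
          StreamSolution α g d lam β p₀' γ' ψ' η → IsStreamFunctionOf d η ψ' u v →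
          p₀' = p₀ ∧ Set.EqOn γ' γ (Set.Icc p₀ 0) ∧ Set.EqOn ψ' ψ (fluidBar d η)) ∧
    -- stream-function formulation to velocity formulation
    (∀ (p₀ : ℝ) (γ : ℝ → ℝ) (ψ : ℝ × ℝ → ℝ) (η : ℝ → ℝ), StreamSolution α g d lam β p₀ γ ψ η →
      ∃ (u v P : ℝ × ℝ → ℝ),
        (VelocitySolution α g d lam β u v P η ∧ IsStreamFunctionOf d η ψ u v) ∧
        ∀ (u' v' P' : ℝ × ℝ → ℝ),
          VelocitySolution α g d lam β u' v' P' η → IsStreamFunctionOf d η ψ u' v' →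
          Set.EqOn u' u (fluidBar d η) ∧ Set.EqOn v' v (fluidBar d η) ∧
            Set.EqOn P' P (fluidBar d η)) ∧
    -- stream-function formulation to height-function formulation
    (∀ (p₀ : ℝ) (γ : ℝ → ℝ) (ψ : ℝ × ℝ → ℝ) (η : ℝ → ℝ), StreamSolution α g d lam β p₀ γ ψ η →
      ∃ h : ℝ × ℝ → ℝ,
        (HeightSolution α g d lam β p₀ γ h ∧ IsHeightFunctionOf d η ψ h) ∧
        ∀ h' : ℝ × ℝ → ℝ,
          HeightSolution α g d lam β p₀ γ h' → IsHeightFunctionOf d η ψ h' →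
          Set.EqOn h' h (stripBar p₀)) ∧
    -- height-function formulation to stream-function formulation
    (∀ (p₀ : ℝ) (γ : ℝ → ℝ) (h : ℝ × ℝ → ℝ), HeightSolution α g d lam β p₀ γ h →
      ∃ (ψ : ℝ × ℝ → ℝ) (η : ℝ → ℝ),
        (StreamSolution α g d lam β p₀ γ ψ η ∧ IsHeightFunctionOf d η ψ h) ∧
        ∀ (ψ' : ℝ × ℝ → ℝ) (η' : ℝ → ℝ),
          StreamSolution α g d lam β p₀ γ ψ' η' → IsHeightFunctionOf d η' ψ' h →
          η' = η ∧ Set.EqOn ψ' ψ (fluidBar d η)) := by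
  refine ⟨fun u v P η h => ?_, fun p₀ γ ψ η h => ?_, fun p₀ γ ψ η h => ?_, fun p₀ γ h hh => ?_⟩
  · obtain ⟨p₀, γ, ψ, hs, he⟩ := h.exists_stream hlam hβ₀ hβ₁
    exact ⟨p₀, γ, ψ, ⟨hs, he⟩, fun p₀' γ' ψ' hs' he' => hs.unique hlam hβ₀ hβ₁ hs' he he'⟩
  · obtain ⟨u, v, P, hv, he⟩ := h.exists_velocity hg hlam hβ₀ hβ₁
    exact ⟨u, v, P, ⟨hv, he⟩, fun u' v' P' hv' he' => hv.unique hlam hβ₀ hβ₁ hv' he he'⟩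
  · obtain ⟨k, hk, he⟩ := h.exists_height hlam hβ₀ hβ₁
    exact ⟨k, ⟨hk, he⟩, fun k' _ he' => h.height_unique hlam hβ₀ hβ₁ he he'⟩
  · obtain ⟨ψ, η, hs, he⟩ := hh.exists_stream hlam hβ₀ hβ₁
    exact ⟨ψ, η, ⟨hs, he⟩,
      fun ψ' η' hs' he' => hh.stream_unique hlam hβ₀ hβ₁ hs hs' he he'⟩
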